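/- Let $(\zeta_k)_{k\ge 0}$ be i.i.d. standard complex Gaussian random variables on a probability space, i.e. $\zeta_k\sim N_{\mathbb C}(0,1)$ has independent real and imaginary parts, each real Gaussian with mean $0$ and variance $1/2$. Let \[ f_0(z)=\sum_{k=0}^\infty \zeta_k\frac{z^k}{\sqrt{k!}},\qquad f_n(z,\bar z)=\frac1{\sqrt{n!}}\,(\partial_z-\bar z)^n f_0(z)\quad(n\ge 0,\ z\in\mathbb C), \] where $\partial_z=\frac12(\partial_x-i\partial_y)$; almost surely, the series defining $f_0(z)$ converges absolutely for every $z\in\mathbb C$. For $N\ge1$ put \[ S_N(z)=\frac1N\sum_{n=0}^{N-1}\bigl|e^{-|z|^2/2}f_n(z,\bar z)\bigr|^2,\qquad z\in\mathbb C. \] For a compact set $K\subset\mathbb C$ and $0<\alpha<1$, let $C^{0,\alpha}(K)$ be the space of continuous functions $u$ on $K$ with \[ [u]_{C^{0,\alpha}(K)}=\sup_{z,w\in K,\ z\ne w}\frac{|u(z)-u(w)|}{|z-w|^\alpha}<\infty, \] with norm $\|u\|_{C^{0,\alpha}(K)}=\sup_{K}|u|+[u]_{C^{0,\alpha}(K)}$.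 Then, for every compact $K\subset\mathbb C$ and every $0<\alpha<1$, almost surely $S_N\to1$ in $C^{0,\alpha}(K)$ as $N\to\infty$; that is, almost surely $S_N|_K\in C^{0,\alpha}(K)$ for all $N$ and $\|S_N-1\|_{C^{0,\alpha}(K)}\to0$. -/

import Mathlib

open MeasureTheory ProbabilityTheory Filter Topology
open scoped ENNReal

noncomputable section

namespace LandauLevels

/-- The standard complex Gaussian law `N_ℂ(0,1)`: independent real and imaginary parts,
each centered Gaussian with variance `1/2`. -/
def stdComplexGaussian : Measure ℂ :=
  ((gaussianReal 0 (1 / 2)).prod (gaussianReal 0 (1 / 2))).map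
    (fun p : ℝ × ℝ => (⟨p.1, p.2⟩ : ℂ))

/-- The `k`-th term `c_k z^k / √(k!)` of the Gaussian entire function with coefficients `c`. -/
def gefTerm (c : ℕ → ℂ) (z : ℂ) (k : ℕ) : ℂ :=
  c k * (z ^ k / (Real.sqrt (k.factorial : ℝ) : ℂ))

/-- `f₀(z) = ∑ₖ c_k z^k / √(k!)`. -/
def gef (c : ℕ → ℂ) (z : ℂ) : ℂ :=
  ∑' k : ℕ, gefTerm c z k

/-- The Wirtinger derivative `∂_z g = (∂_x g - i ∂_y g) / 2`. -/
def dz (g : ℂ → ℂ) (z : ℂ) : ℂ :=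
  (1 / 2 : ℂ) * (fderiv ℝ g z 1 - Complex.I * fderiv ℝ g z Complex.I)

/-- The Landau level raising operator `∂_z - z̄`. -/
def raising (g : ℂ → ℂ) (z : ℂ) : ℂ :=
  dz g z - (starRingEnd ℂ) z * g z

/-- `f_n = (n!)^{-1/2} (∂_z - z̄)^n f₀`. -/
def landauField (c : ℕ → ℂ) (n : ℕ) (z : ℂ) : ℂ :=
  (1 / (Real.sqrt (n.factorial : ℝ) : ℂ)) * (raising^[n] (gef c)) z

/-- `S_N(z) = (1/N) ∑_{n<N} |e^{-|z|²/2} f_n(z)|²`. -/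
def averagedField (c : ℕ → ℂ) (N : ℕ) (z : ℂ) : ℝ :=
  (1 / (N : ℝ)) * ∑ n ∈ Finset.range N,
    ‖(Real.exp (-‖z‖ ^ 2 / 2) : ℂ) * landauField c n z‖ ^ 2

/-- The Hölder seminorm `[u]_{C^{0,α}(K)}`, possibly infinite. -/
def holderSeminorm (α : ℝ) (K : Set ℂ) (u : ℂ → ℝ) : ℝ≥0∞ :=
  ⨆ (z ∈ K) (w ∈ K) (_ : z ≠ w), ENNReal.ofReal (|u z - u w| / ‖z - w‖ ^ α)

/-- The Hölder norm `sup_K |u| + [u]_{C^{0,α}(K)}`, possibly infinite. -/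
def holderNorm (α : ℝ) (K : Set ℂ) (u : ℂ → ℝ) : ℝ≥0∞ :=
  (⨆ z ∈ K, ENNReal.ofReal |u z|) + holderSeminorm α K u

/-- The restriction of `u` to `K` belongs to `C^{0,α}(K)`. -/
def MemHolderSpace (α : ℝ) (K : Set ℂ) (u : ℂ → ℝ) : Prop :=
  ContinuousOn u K ∧ holderSeminorm α K u < ∞

/-- Convergence `u_N → v` in the normed space `C^{0,α}(K)`: all functions belong to the space
and the norm of the difference tends to zero. -/
def TendstoHolder (α : ℝ) (K : Set ℂ) (u : ℕ → ℂ → ℝ) (v : ℂ → ℝ) : Prop :=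
  (∀ N, MemHolderSpace α K (u N)) ∧ MemHolderSpace α K v ∧
    Tendsto (fun N => holderNorm α K (fun z => u N z - v z)) atTop (𝓝 0)

end LandauLevels

end

/-! Write `φ_n = e^{-|z|²/2} f_n`. The Wirtinger derivative telescopes: `∂_z |φ_n|² = J_{n+1} - J_n`
with `J_n = √n φ_n φ̄_{n-1}` (`hasFDerivAt_norm_weightedLevel_sq`), so `∂_z S_N = J_N / N`, of size
at most `N^{-1/2}` times a common bound for `|φ_N|²` and `|φ_{N-1}|²`. If these grow only
logarithmically on discs, the local Lipschitz constants of `S_N` tend to zero. Since `φ_n(0) = ζ_n`,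
the strong law gives `S_N(0) → 1`, and the two facts together give convergence in every Hölder space
with exponent below one.

For the logarithmic growth, expand `φ_n(z) = ∑ ζ_k D_{n,k}(z)`. The rows of `D` have norm at most
one (`sum_exp_mul_normSq_monomialRaised_le`, by a second telescoping, now in `k`), so each value
`φ_n(z)` has Gaussian tails uniformly in `n` and `z`. Borel–Cantelli over lattices of mesh
`(n+2)^{-3}` controls the lattice values (`ae_eventually_grid_le`), and polynomial a priori bounds
on the currents extend this to discs (`exists_norm_weightedLevel_sq_le_of_grid`). -/

noncomputable section

namespace LandauLevels

/-! ### Wirtinger calculus through real Fréchet derivatives -/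

/-- The real-linear map `v ↦ a v + b v̄` with Wirtinger components `a` and `b`. -/
def wirtingerCLM (a b : ℂ) : ℂ →L[ℝ] ℂ :=
  ContinuousLinearMap.mul ℝ ℂ a +
    (ContinuousLinearMap.mul ℝ ℂ b).comp (Complex.conjCLE : ℂ →L[ℝ] ℂ)

@[simp] lemma wirtingerCLM_apply (a b v : ℂ) :
    wirtingerCLM a b v = a * v + b * (starRingEnd ℂ) v := by
  simp [wirtingerCLM]

/-- The real-linear functional `v ↦ 2 Re (a v)`, the differential of a real function whose
Wirtinger derivative is `a`. -/
def reCLM₂ (a : ℂ) : ℂ →L[ℝ] ℝ :=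
  (2 : ℝ) • Complex.reCLM.comp (ContinuousLinearMap.mul ℝ ℂ a)

@[simp] lemma reCLM₂_apply (a v : ℂ) : reCLM₂ a v = 2 * (a * v).re := by
  simp [reCLM₂]

lemma reCLM₂_add (a b : ℂ) : reCLM₂ (a + b) = reCLM₂ a + reCLM₂ b := by
  ext v; simp [add_mul, mul_add]

lemma reCLM₂_zero : reCLM₂ 0 = 0 := by
  ext v; simp

lemma reCLM₂_ofReal_mul (r : ℝ) (a : ℂ) : reCLM₂ (r * a) = r • reCLM₂ a := by
  refine ContinuousLinearMap.ext fun v => ?_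
  rw [smul_apply, reCLM₂_apply, reCLM₂_apply, mul_assoc, Complex.re_ofReal_mul, smul_eq_mul]
  ring

lemma reCLM₂_sum {ι : Type*} (s : Finset ι) (a : ι → ℂ) :
    reCLM₂ (∑ i ∈ s, a i) = ∑ i ∈ s, reCLM₂ (a i) := by
  classical
  induction s using Finset.induction_on with
  | empty => simp [reCLM₂_zero]
  | insert i s hi ih => rw [Finset.sum_insert hi, Finset.sum_insert hi, reCLM₂_add, ih]

lemma norm_reCLM₂_le (a : ℂ) : ‖reCLM₂ a‖ ≤ 2 * ‖a‖ := by
  refine ContinuousLinearMap.opNorm_le_bound _ (by positivity) fun v => ?_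
  rw [reCLM₂_apply, Real.norm_eq_abs, abs_mul, abs_two, mul_assoc, ← norm_mul]
  gcongr
  exact Complex.abs_re_le_norm _

lemma norm_wirtingerCLM_le (a b : ℂ) : ‖wirtingerCLM a b‖ ≤ ‖a‖ + ‖b‖ := by
  refine ContinuousLinearMap.opNorm_le_bound _ (by positivity) fun v => ?_
  rw [wirtingerCLM_apply]
  refine (norm_add_le _ _).trans (le_of_eq ?_)
  simp [add_mul]

lemma hasFDerivAt_conj (z : ℂ) :
    HasFDerivAt (fun z : ℂ => (starRingEnd ℂ) z) (wirtingerCLM 0 1) z := by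
  refine ((Complex.conjCLE : ℂ →L[ℝ] ℂ).hasFDerivAt (x := z)).congr_fderiv ?_
  refine ContinuousLinearMap.ext fun v => ?_
  simp

/-- If `g` has Wirtinger derivatives `a` and `b`, then `e^{-|z|²}|g|²` has `∂_z`-derivative
`e^{-|z|²} (a ḡ + g b̄ - z̄ |g|²)`. -/
lemma hasFDerivAt_exp_mul_normSq {g : ℂ → ℂ} {a b z : ℂ}
    (hg : HasFDerivAt g (wirtingerCLM a b) z) :
    HasFDerivAt (fun z => Real.exp (-‖z‖ ^ 2) * ‖g z‖ ^ 2)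
      (reCLM₂ (Real.exp (-‖z‖ ^ 2) * (a * (starRingEnd ℂ) (g z) + g z * (starRingEnd ℂ) b
        - (starRingEnd ℂ) z * (g z * (starRingEnd ℂ) (g z))))) z := by
  have h3 := (((hasFDerivAt_id (𝕜 := ℝ) z).norm_sq.neg).exp).mul hg.norm_sq
  simp only [id, Pi.neg_apply] at h3
  refine h3.congr_fderiv ?_
  have e1 : ‖g z‖ ^ 2 = (g z).re * (g z).re + (g z).im * (g z).im := by
    rw [← Complex.normSq_eq_norm_sq, Complex.normSq_apply]
  rw [e1]
  generalize Real.exp (-‖z‖ ^ 2) = e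
  refine ContinuousLinearMap.ext fun v => ?_
  simp [real_inner_eq_re_inner, RCLike.inner_apply]
  ring

/-! ### Raised monomials: ladder identities and crude bounds -/

lemma sqrt_factorial_succ (k : ℕ) :
    Real.sqrt ((k + 1).factorial : ℝ) = Real.sqrt (k + 1 : ℕ) * Real.sqrt (k.factorial : ℝ) := by
  rw [Nat.factorial_succ, Nat.cast_mul, Real.sqrt_mul (by positivity)]

lemma sqrt_factorial_pos (k : ℕ) : 0 < Real.sqrt (k.factorial : ℝ) :=
  Real.sqrt_pos.2 (by exact_mod_cast k.factorial_pos)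

lemma ofReal_sqrt_mul_self (k : ℕ) :
    (Real.sqrt (k : ℝ) : ℂ) * (Real.sqrt (k : ℝ) : ℂ) = k := by
  rw [← Complex.ofReal_mul, Real.mul_self_sqrt (by positivity)]
  simp

/-- `(∂_z - z̄)^n` applied to the normalized monomial `z^k / √(k!)`. -/
def monomialRaised : ℕ → ℕ → ℂ → ℂ
  | 0, k, z => z ^ k / (Real.sqrt (k.factorial : ℝ) : ℂ)
  | n + 1, k, z => (Real.sqrt (k : ℝ) : ℂ) * monomialRaised n (k - 1) z
      - (starRingEnd ℂ) z * monomialRaised n k z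

lemma monomialRaised_zero (k : ℕ) (z : ℂ) :
    monomialRaised 0 k z = z ^ k / (Real.sqrt (k.factorial : ℝ) : ℂ) := rfl

lemma monomialRaised_succ (n k : ℕ) (z : ℂ) :
    monomialRaised (n + 1) k z = (Real.sqrt (k : ℝ) : ℂ) * monomialRaised n (k - 1) z
      - (starRingEnd ℂ) z * monomialRaised n k z := rfl

/-- The factor `n` kills the spurious case `n = 0` of truncated subtraction. -/
lemma mul_monomialRaised_pred (n k : ℕ) (z : ℂ) :
    (n : ℂ) * monomialRaised n k z = (n : ℂ) *
      ((Real.sqrt (k : ℝ) : ℂ) * monomialRaised (n - 1) (k - 1) z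
        - (starRingEnd ℂ) z * monomialRaised (n - 1) k z) := by
  cases n with
  | zero => simp
  | succ n => rw [Nat.add_sub_cancel, monomialRaised_succ]

/-- `∂_z` commutes with `∂_z - z̄` and lowers `k`, while the commutator of `∂_z̄` with `∂_z - z̄` is
`-1`, which produces the factor `-n`. The factors `√k` and `n` make the truncated indices harmless
at zero. -/
lemma hasFDerivAt_monomialRaised (n k : ℕ) (z : ℂ) :
    HasFDerivAt (monomialRaised n k)
      (wirtingerCLM ((Real.sqrt (k : ℝ) : ℂ) * monomialRaised n (k - 1) z)
        (-(n : ℂ) * monomialRaised (n - 1) k z)) z := by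
  induction n generalizing k with
  | zero =>
    have h := (((hasDerivAt_pow k z).div_const
      (Real.sqrt (k.factorial : ℝ) : ℂ)).hasFDerivAt).restrictScalars ℝ
    refine h.congr_fderiv ?_
    refine ContinuousLinearMap.ext fun v => ?_
    cases k with
    | zero => simp
    | succ k =>
      have h1 : (Real.sqrt (k.factorial : ℝ) : ℂ) ≠ 0 := by
        exact_mod_cast (sqrt_factorial_pos k).ne'
      have h2 : (Real.sqrt ((k + 1 : ℕ) : ℝ) : ℂ) ≠ 0 := by
        exact_mod_cast (Real.sqrt_pos.2 (by positivity)).ne'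
      have h3 := ofReal_sqrt_mul_self (k + 1)
      rw [sqrt_factorial_succ, Complex.ofReal_mul]
      simp only [monomialRaised_zero, Nat.add_sub_cancel, wirtingerCLM_apply,
        ContinuousLinearMap.coe_restrictScalars', ContinuousLinearMap.toSpanSingleton_apply,
        smul_eq_mul]
      rw [← h3]
      field_simp
      simp
  | succ n ih =>
    have h := ((ih (k - 1)).const_mul (Real.sqrt (k : ℝ) : ℂ)).sub
      ((hasFDerivAt_conj z).mul (ih k))
    refine h.congr_fderiv ?_
    refine ContinuousLinearMap.ext fun v => ?_
    have h1 := mul_monomialRaised_pred n k z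
    simp only [sub_apply, add_apply, smul_apply, wirtingerCLM_apply, smul_eq_mul, Nat.add_sub_cancel,
      monomialRaised_succ]
    push_cast
    linear_combination ((starRingEnd ℂ) v) * h1

/-- The lowering identity `√(k+1) E_{n,k+1} = z E_{n,k} + n E_{n-1,k}`. -/
lemma sqrt_mul_monomialRaised_succ (n k : ℕ) (z : ℂ) :
    (Real.sqrt ((k + 1 : ℕ) : ℝ) : ℂ) * monomialRaised n (k + 1) z =
      z * monomialRaised n k z + n * monomialRaised (n - 1) k z := by
  induction n generalizing k with
  | zero =>
    have h1 : (Real.sqrt (k.factorial : ℝ) : ℂ) ≠ 0 := by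
      exact_mod_cast (sqrt_factorial_pos k).ne'
    have h2 : (Real.sqrt ((k + 1 : ℕ) : ℝ) : ℂ) ≠ 0 := by
      exact_mod_cast (Real.sqrt_pos.2 (by positivity)).ne'
    simp only [monomialRaised_zero]
    rw [sqrt_factorial_succ, Complex.ofReal_mul]
    field_simp
    simp
    ring
  | succ n ih =>
    have h1 := mul_monomialRaised_pred n k z
    have h2 := ofReal_sqrt_mul_self (k + 1)
    have h3 := ofReal_sqrt_mul_self k
    have h4 := ih k
    -- The induction hypothesis at `k - 1`, multiplied by `√k` so that it also holds at `k = 0`.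
    have h5 : (Real.sqrt (k : ℝ) : ℂ) * ((Real.sqrt (k : ℝ) : ℂ) * monomialRaised n k z) =
        (Real.sqrt (k : ℝ) : ℂ) * (z * monomialRaised n (k - 1) z
          + n * monomialRaised (n - 1) (k - 1) z) := by
      cases k with
      | zero => simp
      | succ k => rw [ih k]; simp
    simp only [monomialRaised_succ, Nat.add_sub_cancel]
    push_cast at *
    linear_combination (monomialRaised n k z) * h2 - (starRingEnd ℂ) z * h4 -
      (monomialRaised n k z) * h3 + h5 - h1

/-- Each raising costs at most `k + R ≤ 2R(k + 1)`: the shift to `k - 1` contributes `k` and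
multiplication by `z̄` contributes `R`. The bound is far from sharp in `n`; it serves convergence in
`k` for fixed `n`. -/
lemma norm_monomialRaised_le {R : ℝ} (hR : 1 ≤ R) (n k : ℕ) {z : ℂ} (hz : ‖z‖ ≤ R) :
    ‖monomialRaised n k z‖ ≤
      (2 * R * (k + 1)) ^ n * (R ^ k / Real.sqrt (k.factorial : ℝ)) := by
  have hR0 : 0 ≤ R := by linarith
  induction n generalizing k with
  | zero =>
    rw [monomialRaised_zero, norm_div, norm_pow, Complex.norm_real, Real.norm_eq_abs,
      abs_of_nonneg (Real.sqrt_nonneg _), pow_zero, one_mul]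
    gcongr
  | succ n ih =>
    set B := (2 * R * (k + 1)) ^ n * (R ^ k / Real.sqrt (k.factorial : ℝ)) with hB
    have hB0 : 0 ≤ B := by positivity
    have h1 : ‖(Real.sqrt (k : ℝ) : ℂ) * monomialRaised n (k - 1) z‖ ≤ k * B := by
      rw [norm_mul, Complex.norm_real, Real.norm_eq_abs, abs_of_nonneg (Real.sqrt_nonneg _)]
      cases k with
      | zero => simp
      | succ k =>
        have hs : 0 < Real.sqrt ((k + 1 : ℕ) : ℝ) := Real.sqrt_pos.2 (by positivity)
        have hss : Real.sqrt ((k + 1 : ℕ) : ℝ) * Real.sqrt ((k + 1 : ℕ) : ℝ) = (k + 1 : ℕ) :=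
          Real.mul_self_sqrt (by positivity)
        have hf := sqrt_factorial_pos k
        calc _ ≤ Real.sqrt ((k + 1 : ℕ) : ℝ) *
              ((2 * R * (k + 1)) ^ n * (R ^ k / Real.sqrt (k.factorial : ℝ))) := by
              gcongr
              exact ih k
          _ ≤ Real.sqrt ((k + 1 : ℕ) : ℝ) * ((2 * R * ((k + 1 : ℕ) + 1)) ^ n *
              (R ^ (k + 1) / Real.sqrt (k.factorial : ℝ))) := by
              gcongr
              · linarith
              · omega
          _ = _ := by
              rw [hB, sqrt_factorial_succ]
              generalize Real.sqrt ((k + 1 : ℕ) : ℝ) = s at hs hss ⊢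
              rw [← hss]
              field_simp
    calc ‖monomialRaised (n + 1) k z‖ ≤ k * B + R * B := by
          rw [monomialRaised_succ]
          refine (norm_sub_le _ _).trans (add_le_add h1 ?_)
          rw [norm_mul, RCLike.norm_conj]
          gcongr
          exact ih k
      _ ≤ (2 * R * (k + 1)) * B := by
          rw [← add_mul]
          gcongr
          have : (0 : ℝ) ≤ k := by positivity
          nlinarith
      _ = _ := by rw [hB]; ring

/-- At the origin the `z̄` term drops out of the recursion, which then moves along diagonals. -/
lemma monomialRaised_apply_zero (n k : ℕ) :
    monomialRaised n k 0 = if n = k then (Real.sqrt (n.factorial : ℝ) : ℂ) else 0 := by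
  induction n generalizing k with
  | zero =>
    rw [monomialRaised_zero]
    rcases k with _ | k
    · simp
    · simp
  | succ n ih =>
    rw [monomialRaised_succ, ih]
    rcases k with _ | k
    · simp
    · rw [sqrt_factorial_succ]
      by_cases h : n = k
      · subst h; simp
      · simp [h]

/-! ### Row norms by telescoping in the monomial index -/

/-- The series dominating the matrix elements is summable even against powers of the index. -/
lemma summable_pow_mul_pow_div_sqrt_factorial (p : ℕ) (R : ℝ) :
    Summable fun k : ℕ => ((k : ℝ) + 1) ^ p * (R ^ k / Real.sqrt (k.factorial : ℝ)) := by
  have h1 : Summable fun k : ℕ =>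
      ((2 * p).factorial * Real.exp 1) * ((4 * R ^ 2 * Real.exp 1) ^ k / k.factorial) +
        (1 / 4 : ℝ) ^ k :=
    ((Real.summable_pow_div_factorial _).mul_left _).add
      (summable_geometric_of_lt_one (by norm_num) (by norm_num))
  refine Summable.of_norm_bounded h1 fun k => ?_
  have hf := sqrt_factorial_pos k
  have hff : Real.sqrt (k.factorial : ℝ) ^ 2 = k.factorial := Real.sq_sqrt (by positivity)
  have h2 : ((k : ℝ) + 1) ^ (2 * p) ≤ (2 * p).factorial * Real.exp ((k : ℝ) + 1) := by
    have := Real.pow_div_factorial_le_exp ((k : ℝ) + 1) (by positivity) (2 * p)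
    rwa [div_le_iff₀' (by positivity)] at this
  have h3 : Real.exp ((k : ℝ) + 1) = Real.exp 1 * Real.exp 1 ^ k := by
    rw [Real.exp_add, mul_comm, ← Real.exp_nat_mul, mul_one]
  -- Splitting `|R|^k = (2|R|)^k 2^{-k}` and applying AM–GM bounds the term by `x² + 4^{-k}`;
  -- squaring removes the root from the factorial.
  set x : ℝ := ((k : ℝ) + 1) ^ p * ((2 * |R|) ^ k / Real.sqrt (k.factorial : ℝ)) with hx
  have hy : (1 / 4 : ℝ) ^ k = ((1 / 2) ^ k) ^ 2 := by rw [← pow_mul, mul_comm, pow_mul]; norm_num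
  have hxy : ‖((k : ℝ) + 1) ^ p * (R ^ k / Real.sqrt (k.factorial : ℝ))‖ = x * (1 / 2) ^ k := by
    rw [norm_mul, norm_div, norm_pow, norm_pow, Real.norm_eq_abs R, Real.norm_of_nonneg hf.le,
      Real.norm_of_nonneg (by positivity), hx]
    have h5 : |R| ^ k = (2 * |R|) ^ k * (1 / 2) ^ k := by
      rw [← mul_pow]
      congr 1
      ring
    rw [h5]
    ring
  have hx2 : x ^ 2 = ((k : ℝ) + 1) ^ (2 * p) * ((4 * R ^ 2) ^ k / k.factorial) := by
    rw [hx, mul_pow, div_pow, hff, ← pow_mul, ← pow_mul, mul_comm p, mul_comm k, pow_mul (2 * |R|),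
      mul_pow, sq_abs]
    norm_num
  rw [hxy, hy]
  have h4 : x ^ 2 ≤ ((2 * p).factorial * Real.exp 1) *
      ((4 * R ^ 2 * Real.exp 1) ^ k / k.factorial) := by
    rw [hx2]
    calc _ ≤ ((2 * p).factorial * Real.exp ((k : ℝ) + 1)) * ((4 * R ^ 2) ^ k / k.factorial) := by
          gcongr
      _ = _ := by rw [h3, mul_pow (4 * R ^ 2)]; ring
  nlinarith [sq_nonneg (x - (1 / 2) ^ k), sq_nonneg x, sq_nonneg ((1 / 2 : ℝ) ^ k)]

/-- By the lowering identity each summand has `∂_z`-derivative `A_k - A_{k+1}` with `A_k = e^{-|z|²}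
√k E_{n,k-1} Ē_{n,k}`, where `E` is `monomialRaised`. Since `A_0 = 0`, only `-A_K` remains. -/
lemma hasFDerivAt_sum_exp_mul_normSq_monomialRaised (n K : ℕ) (z : ℂ) :
    HasFDerivAt (fun z => ∑ k ∈ Finset.range K, Real.exp (-‖z‖ ^ 2) * ‖monomialRaised n k z‖ ^ 2)
      (reCLM₂ (Real.exp (-‖z‖ ^ 2) * -((Real.sqrt (K : ℝ) : ℂ) * monomialRaised n (K - 1) z *
        (starRingEnd ℂ) (monomialRaised n K z)))) z := by
  have h := HasFDerivAt.fun_sum (u := Finset.range K) fun k _ =>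
    hasFDerivAt_exp_mul_normSq (hasFDerivAt_monomialRaised n k z)
  refine h.congr_fderiv ?_
  rw [← reCLM₂_sum, ← Finset.mul_sum]
  congr 2
  clear h
  induction K with
  | zero => simp
  | succ K ih =>
    have h1 := congrArg (starRingEnd ℂ) (sqrt_mul_monomialRaised_succ n K z)
    simp only [map_add, map_mul, Complex.conj_ofReal, map_natCast] at h1
    rw [Finset.sum_range_succ, ih]
    simp only [map_neg, map_mul, map_natCast, Nat.add_sub_cancel]
    linear_combination (monomialRaised n K z) * h1

lemma sum_normSq_monomialRaised_apply_zero_le (n K : ℕ) :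
    ∑ k ∈ Finset.range K, ‖monomialRaised n k 0‖ ^ 2 ≤ (n.factorial : ℝ) := by
  have h : ∀ k, ‖monomialRaised n k 0‖ ^ 2 = if n = k then (n.factorial : ℝ) else 0 := by
    intro k
    rw [monomialRaised_apply_zero]
    split_ifs
    · rw [Complex.norm_real, Real.norm_eq_abs, sq_abs, Real.sq_sqrt (by positivity)]
    · simp
  simp only [h, Finset.sum_ite_eq]
  split_ifs
  · exact le_rfl
  · positivity

/-- Rows of the matrix of the Weyl translation have norm at most one. -/
lemma sum_exp_mul_normSq_monomialRaised_le (n K : ℕ) (z : ℂ) :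
    ∑ k ∈ Finset.range K, Real.exp (-‖z‖ ^ 2) * ‖monomialRaised n k z‖ ^ 2 ≤ n.factorial := by
  set R : ℝ := 1 + ‖z‖ with hR
  have hR1 : 1 ≤ R := by rw [hR]; linarith [norm_nonneg z]
  have hR0 : 0 ≤ R := by linarith
  set T : ℕ → ℂ → ℝ := fun K z =>
    ∑ k ∈ Finset.range K, Real.exp (-‖z‖ ^ 2) * ‖monomialRaised n k z‖ ^ 2 with hT
  set b : ℕ → ℝ := fun k => (2 * R * (k + 1)) ^ n * (R ^ k / Real.sqrt (k.factorial : ℝ)) with hb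
  have hb0 : ∀ k, 0 ≤ b k := fun k => by positivity
  have hTmono : ∀ j, T K z ≤ T (K + j) z := fun j =>
    Finset.sum_le_sum_of_subset_of_nonneg (Finset.range_mono (by omega))
      fun _ _ _ => by positivity
  -- The mean value inequality from the origin: the gradient is a single boundary term, bounded by a
  -- product that tends to zero in `j`. Monotonicity in the cutoff then transfers the limiting bound
  -- to `T K z`.
  have hbound : ∀ j, T (j + 1) z ≤ n.factorial + 2 * (((j : ℝ) + 1) * b j * b (j + 1)) * R := by
    intro j
    have hlip : ‖T (j + 1) z - T (j + 1) 0‖ ≤ 2 * (((j : ℝ) + 1) * b j * b (j + 1)) * ‖z - 0‖ := by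
      refine (convex_closedBall (0 : ℂ) R).norm_image_sub_le_of_norm_hasFDerivWithin_le
        (fun x _ => (hasFDerivAt_sum_exp_mul_normSq_monomialRaised n (j + 1) x).hasFDerivWithinAt)
        (fun x hx => ?_) (Metric.mem_closedBall_self hR0) ?_
      · have hx' : ‖x‖ ≤ R := by simpa using hx
        refine (norm_reCLM₂_le _).trans ?_
        gcongr
        rw [norm_mul, norm_neg, norm_mul, norm_mul, RCLike.norm_conj, Nat.add_sub_cancel,
          Complex.norm_real, Complex.norm_real, Real.norm_of_nonneg (Real.exp_pos _).le,
          Real.norm_of_nonneg (Real.sqrt_nonneg _)]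
        have h1 : Real.exp (-‖x‖ ^ 2) ≤ 1 := Real.exp_le_one_iff.2 (by nlinarith [norm_nonneg x])
        have h2 : Real.sqrt ((j + 1 : ℕ) : ℝ) ≤ (j : ℝ) + 1 := by
          rw [Real.sqrt_le_left (by positivity)]
          push_cast
          nlinarith [(Nat.cast_nonneg j : (0 : ℝ) ≤ j)]
        have h3 := norm_monomialRaised_le hR1 n j hx'
        have h4 := norm_monomialRaised_le hR1 n (j + 1) hx'
        calc _ ≤ 1 * (((j : ℝ) + 1) * b j * b (j + 1)) := by
              gcongr
          _ = _ := one_mul _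
      · simp [hR]
    have h0 : T (j + 1) 0 ≤ n.factorial := by
      simpa [hT] using sum_normSq_monomialRaised_apply_zero_le n (j + 1)
    have h5 : ‖z - 0‖ ≤ R := by simp [hR]
    have h6 := (le_abs_self _).trans (hlip.trans
      (mul_le_mul_of_nonneg_left h5 (by have := hb0 j; have := hb0 (j + 1); positivity)))
    linarith
  have ht1 : Tendsto (fun j : ℕ => ((j : ℝ) + 1) * b j) atTop (𝓝 0) := by
    have := ((summable_pow_mul_pow_div_sqrt_factorial (n + 1) R).mul_left
      ((2 * R) ^ n)).tendsto_atTop_zero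
    refine this.congr fun j => ?_
    simp only [hb]
    rw [mul_pow (2 * R)]
    ring
  have ht2 : Tendsto (fun j : ℕ => b (j + 1)) atTop (𝓝 0) := by
    have := ((summable_pow_mul_pow_div_sqrt_factorial n R).mul_left
      ((2 * R) ^ n)).tendsto_atTop_zero
    refine (tendsto_add_atTop_iff_nat 1).2 (this.congr fun j => ?_)
    simp only [hb]
    rw [mul_pow (2 * R)]
    ring
  have ht : Tendsto (fun j : ℕ => (n.factorial : ℝ) + 2 * (((j : ℝ) + 1) * b j * b (j + 1)) * R)
      atTop (𝓝 n.factorial) := by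
    simpa using (((ht1.mul ht2).const_mul 2).mul_const R).const_add (n.factorial : ℝ)
  refine ge_of_tendsto ht ?_
  filter_upwards [eventually_ge_atTop K] with j hj
  refine le_trans ?_ (hbound j)
  have := hTmono (j + 1 - K)
  rwa [show K + (j + 1 - K) = j + 1 by omega] at this

/-! ### Normalized matrix elements and their moments in the column index -/

/-- The matrix elements of the Weyl translation by `z` in the Fock basis: the value at `z` of
`e^{-|z|²/2} f_n` when `f₀` is the `k`-th normalized monomial. -/
def displacement (n k : ℕ) (z : ℂ) : ℂ :=
  (Real.exp (-‖z‖ ^ 2 / 2) : ℂ) * ((1 / (Real.sqrt (n.factorial : ℝ) : ℂ)) * monomialRaised n k z)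

lemma norm_weight_sq (n : ℕ) (z w : ℂ) :
    ‖(Real.exp (-‖z‖ ^ 2 / 2) : ℂ) * ((1 / (Real.sqrt (n.factorial : ℝ) : ℂ)) * w)‖ ^ 2 =
      Real.exp (-‖z‖ ^ 2) * ‖w‖ ^ 2 / n.factorial := by
  rw [norm_mul, norm_mul, norm_div, Complex.norm_real, Complex.norm_real,
    Real.norm_of_nonneg (Real.exp_pos _).le, Real.norm_of_nonneg (Real.sqrt_nonneg _), mul_pow,
    mul_pow, div_pow, Real.sq_sqrt (by positivity), ← Real.exp_nat_mul]
  rw [show ((2 : ℕ) : ℝ) * (-‖z‖ ^ 2 / 2) = -‖z‖ ^ 2 by push_cast; ring]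
  simp
  ring

lemma sum_norm_displacement_sq_le_one (n K : ℕ) (z : ℂ) :
    ∑ k ∈ Finset.range K, ‖displacement n k z‖ ^ 2 ≤ 1 := by
  have h := sum_exp_mul_normSq_monomialRaised_le n K z
  simp only [displacement, norm_weight_sq]
  rw [← Finset.sum_div]
  exact div_le_one_of_le₀ h (by positivity)

lemma sqrt_mul_div_sqrt_factorial (n : ℕ) (x : ℂ) :
    (1 / (Real.sqrt (n.factorial : ℝ) : ℂ)) * (n * x) =
      (Real.sqrt (n : ℝ) : ℂ) * ((1 / (Real.sqrt ((n - 1).factorial : ℝ) : ℂ)) * x) := by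
  cases n with
  | zero => simp
  | succ n =>
    have h1 : (Real.sqrt (n.factorial : ℝ) : ℂ) ≠ 0 := by
      exact_mod_cast (sqrt_factorial_pos n).ne'
    have h2 : (Real.sqrt ((n + 1 : ℕ) : ℝ) : ℂ) ≠ 0 := by
      exact_mod_cast (Real.sqrt_pos.2 (by positivity)).ne'
    rw [← ofReal_sqrt_mul_self, sqrt_factorial_succ, Complex.ofReal_mul, Nat.add_sub_cancel]
    field_simp

lemma sqrt_mul_displacement_succ (n k : ℕ) (z : ℂ) :
    (Real.sqrt ((k + 1 : ℕ) : ℝ) : ℂ) * displacement n (k + 1) z =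
      z * displacement n k z + (Real.sqrt (n : ℝ) : ℂ) * displacement (n - 1) k z := by
  have h1 := sqrt_mul_monomialRaised_succ n k z
  have h2 := sqrt_mul_div_sqrt_factorial n (monomialRaised (n - 1) k z)
  simp only [displacement]
  generalize (1 / (Real.sqrt (n.factorial : ℝ) : ℂ)) = y at h2 ⊢
  generalize (Real.exp (-‖z‖ ^ 2 / 2) : ℂ) = e
  linear_combination e * y * h1 + e * h2

/-- Trades one power of `k` for `‖z‖²` and `n`, so moments along a row follow by induction from its
norm bound. -/
lemma succ_mul_norm_displacement_sq_le (n k : ℕ) (z : ℂ) :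
    ((k : ℝ) + 1) * ‖displacement n (k + 1) z‖ ^ 2 ≤
      2 * ‖z‖ ^ 2 * ‖displacement n k z‖ ^ 2 + 2 * n * ‖displacement (n - 1) k z‖ ^ 2 := by
  have h := congrArg (fun x => ‖x‖ ^ 2) (sqrt_mul_displacement_succ n k z)
  simp only [norm_mul, mul_pow, Complex.norm_real, Real.norm_eq_abs, sq_abs] at h
  rw [Real.sq_sqrt (by positivity)] at h
  push_cast at h
  rw [h]
  have h1 := norm_add_le (z * displacement n k z)
    ((Real.sqrt (n : ℝ) : ℂ) * displacement (n - 1) k z)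
  have h2 : ‖(Real.sqrt (n : ℝ) : ℂ) * displacement (n - 1) k z‖ ^ 2 =
      n * ‖displacement (n - 1) k z‖ ^ 2 := by
    rw [norm_mul, mul_pow, Complex.norm_real, Real.norm_eq_abs, sq_abs,
      Real.sq_sqrt (by positivity)]
  have h3 : ‖z * displacement n k z‖ ^ 2 = ‖z‖ ^ 2 * ‖displacement n k z‖ ^ 2 := by
    rw [norm_mul, mul_pow]
  have h4 := add_sq_le (a := ‖z * displacement n k z‖)
    (b := ‖(Real.sqrt (n : ℝ) : ℂ) * displacement (n - 1) k z‖)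
  rw [h2, h3] at h4
  refine (pow_le_pow_left₀ (norm_nonneg _) h1 2).trans (h4.trans (le_of_eq ?_))
  ring

lemma sum_mul_norm_displacement_sq_le (n K : ℕ) (z : ℂ) :
    ∑ k ∈ Finset.range K, (k : ℝ) * ‖displacement n k z‖ ^ 2 ≤ 2 * ‖z‖ ^ 2 + 2 * n := by
  rcases K with _ | K
  · simp; positivity
  rw [Finset.sum_range_succ']
  have h1 := sum_norm_displacement_sq_le_one n K z
  have h2 := sum_norm_displacement_sq_le_one (n - 1) K z
  calc _ ≤ ∑ k ∈ Finset.range K, (2 * ‖z‖ ^ 2 * ‖displacement n k z‖ ^ 2 +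
        2 * n * ‖displacement (n - 1) k z‖ ^ 2) := by
        simp only [Nat.cast_zero, zero_mul, add_zero, Nat.cast_add, Nat.cast_one]
        exact Finset.sum_le_sum fun k _ => succ_mul_norm_displacement_sq_le n k z
    _ ≤ 2 * ‖z‖ ^ 2 * 1 + 2 * n * 1 := by
        rw [Finset.sum_add_distrib, ← Finset.mul_sum, ← Finset.mul_sum]
        gcongr
    _ = _ := by ring

/-- The factorial moment is used because the shift `k ↦ k + 1` turns `k(k - 1)` into `(k + 1)k`: the
trade removes `k + 1` and leaves the first moment. -/
lemma sum_mul_sub_one_mul_norm_displacement_sq_le (n K : ℕ) (z : ℂ) :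
    ∑ k ∈ Finset.range K, (k : ℝ) * (k - 1) * ‖displacement n k z‖ ^ 2 ≤
      (2 * ‖z‖ ^ 2 + 2 * n) ^ 2 := by
  rcases K with _ | K
  · simp; positivity
  rw [Finset.sum_range_succ']
  have h1 := sum_mul_norm_displacement_sq_le n K z
  have h2 : ∑ k ∈ Finset.range K, (k : ℝ) * ‖displacement (n - 1) k z‖ ^ 2 ≤
      2 * ‖z‖ ^ 2 + 2 * n := by
    refine (sum_mul_norm_displacement_sq_le (n - 1) K z).trans ?_
    gcongr
    omega
  calc _ ≤ ∑ k ∈ Finset.range K, (2 * ‖z‖ ^ 2 * (k * ‖displacement n k z‖ ^ 2) +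
        2 * n * (k * ‖displacement (n - 1) k z‖ ^ 2)) := by
        simp only [Nat.cast_zero, zero_mul, add_zero, Nat.cast_add, Nat.cast_one]
        refine Finset.sum_le_sum fun k _ => ?_
        have := mul_le_mul_of_nonneg_left (succ_mul_norm_displacement_sq_le n k z)
          (Nat.cast_nonneg k : (0 : ℝ) ≤ k)
        linarith
    _ ≤ 2 * ‖z‖ ^ 2 * (2 * ‖z‖ ^ 2 + 2 * n) + 2 * n * (2 * ‖z‖ ^ 2 + 2 * n) := by
        rw [Finset.sum_add_distrib, ← Finset.mul_sum, ← Finset.mul_sum]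
        gcongr
    _ = _ := by ring

lemma sum_succ_sq_mul_norm_displacement_sq_le (n K : ℕ) (z : ℂ) :
    ∑ k ∈ Finset.range K, ((k : ℝ) + 1) ^ 2 * ‖displacement n k z‖ ^ 2 ≤
      4 * ((1 + ‖z‖ ^ 2) * (2 * n + 2)) ^ 2 := by
  have h0 := sum_norm_displacement_sq_le_one n K z
  have h1 := sum_mul_norm_displacement_sq_le n K z
  have h2 := sum_mul_sub_one_mul_norm_displacement_sq_le n K z
  have h : ∑ k ∈ Finset.range K, ((k : ℝ) + 1) ^ 2 * ‖displacement n k z‖ ^ 2 =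
      ∑ k ∈ Finset.range K, (k : ℝ) * (k - 1) * ‖displacement n k z‖ ^ 2 +
      3 * ∑ k ∈ Finset.range K, (k : ℝ) * ‖displacement n k z‖ ^ 2 +
      ∑ k ∈ Finset.range K, ‖displacement n k z‖ ^ 2 := by
    rw [Finset.mul_sum, ← Finset.sum_add_distrib, ← Finset.sum_add_distrib]
    exact Finset.sum_congr rfl fun k _ => by ring
  rw [h]
  have hn : (0 : ℝ) ≤ n := by positivity
  have hz : 0 ≤ ‖z‖ ^ 2 := by positivity
  -- With `y = 2‖z‖² + 2n` the moments sum to at most `y² + 3y + 1 ≤ 4(y + 1)²`.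
  have hx : 2 * ‖z‖ ^ 2 + 2 * n + 1 ≤ (1 + ‖z‖ ^ 2) * (2 * n + 2) := by nlinarith
  have hx' := pow_le_pow_left₀ (by positivity) hx 2
  nlinarith

/-! ### Random series: convergence and termwise differentiation -/

/-- The series `∑ₖ c_k (∂_z - z̄)^n (z^k / √(k!))`. -/
def raisedSeries (c : ℕ → ℂ) (n : ℕ) (z : ℂ) : ℂ :=
  ∑' k, c k * monomialRaised n k z

/-- The weighted square summability satisfied almost surely by Gaussian coefficients. -/
def AdmissibleCoeff (c : ℕ → ℂ) : Prop :=
  Summable fun k : ℕ => ‖c k‖ ^ 2 / ((k : ℝ) + 1) ^ 2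

namespace AdmissibleCoeff

variable {c : ℕ → ℂ}

lemma exists_norm_le (hc : AdmissibleCoeff c) : ∃ A : ℝ, 0 ≤ A ∧ ∀ k, ‖c k‖ ≤ A * ((k : ℝ) + 1) := by
  refine ⟨Real.sqrt (∑' k : ℕ, ‖c k‖ ^ 2 / ((k : ℝ) + 1) ^ 2), Real.sqrt_nonneg _, fun k => ?_⟩
  have h : ‖c k‖ ^ 2 / ((k : ℝ) + 1) ^ 2 ≤ ∑' k : ℕ, ‖c k‖ ^ 2 / ((k : ℝ) + 1) ^ 2 :=
    Summable.le_tsum hc k fun j _ => by positivity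
  rw [← div_pow] at h
  have := Real.le_sqrt_of_sq_le h
  rwa [div_le_iff₀ (by positivity)] at this

/-- A summable majorant, uniform on discs, of the terms of `raisedSeries`. -/
lemma exists_majorant (hc : AdmissibleCoeff c) (n : ℕ) {R : ℝ} (hR : 1 ≤ R) :
    ∃ u : ℕ → ℝ, Summable u ∧ ∀ k, ∀ z : ℂ, ‖z‖ ≤ R → ‖c k * monomialRaised n k z‖ ≤ u k := by
  obtain ⟨A, hA, hcA⟩ := hc.exists_norm_le
  refine ⟨_, (summable_pow_mul_pow_div_sqrt_factorial (n + 1) R).mul_left (A * (2 * R) ^ n),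
    fun k z hz => ?_⟩
  rw [norm_mul]
  calc _ ≤ (A * ((k : ℝ) + 1)) *
        ((2 * R * (k + 1)) ^ n * (R ^ k / Real.sqrt (k.factorial : ℝ))) := by
        gcongr
        · exact hcA k
        · exact norm_monomialRaised_le hR n k hz
    _ = _ := by rw [mul_pow (2 * R)]; ring

lemma summable_norm (hc : AdmissibleCoeff c) (n : ℕ) (z : ℂ) :
    Summable fun k => ‖c k * monomialRaised n k z‖ := by
  obtain ⟨u, hu, h⟩ := hc.exists_majorant n (R := 1 + ‖z‖) (by linarith [norm_nonneg z])
  exact Summable.of_nonneg_of_le (fun _ => norm_nonneg _) (fun k => h k z (by linarith)) hu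

lemma hasSum (hc : AdmissibleCoeff c) (n : ℕ) (z : ℂ) :
    HasSum (fun k => c k * monomialRaised n k z) (raisedSeries c n z) :=
  (hc.summable_norm n z).of_norm.hasSum

lemma summable_gefTerm (hc : AdmissibleCoeff c) (z : ℂ) : Summable (gefTerm c z) :=
  (hc.hasSum 0 z).summable

lemma hasFDerivAt_raisedSeries (hc : AdmissibleCoeff c) (n : ℕ) (z : ℂ) :
    HasFDerivAt (raisedSeries c n)
      (wirtingerCLM (raisedSeries c (n + 1) z + (starRingEnd ℂ) z * raisedSeries c n z)
        (-(n : ℂ) * raisedSeries c (n - 1) z)) z := by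
  set R : ℝ := 1 + ‖z‖ with hR
  have hR1 : 1 ≤ R := by linarith [norm_nonneg z]
  obtain ⟨u, hu, hub⟩ := hc.exists_majorant n hR1
  obtain ⟨v, hv, hvb⟩ := hc.exists_majorant (n + 1) hR1
  obtain ⟨w, hw, hwb⟩ := hc.exists_majorant (n - 1) hR1
  -- The recursion rewrites `√k E_{n,k-1}` as `E_{n+1,k} + z̄ E_{n,k}`, so the summed derivative
  -- involves only levels `n - 1`, `n`, `n + 1` with the same coefficients.
  set f' : ℕ → ℂ → (ℂ →L[ℝ] ℂ) := fun k x => wirtingerCLM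
    (c k * monomialRaised (n + 1) k x + (starRingEnd ℂ) x * (c k * monomialRaised n k x))
    (-(n : ℂ) * (c k * monomialRaised (n - 1) k x)) with hf'
  have hbd : ∀ k, ∀ x ∈ Metric.ball (0 : ℂ) R, ‖f' k x‖ ≤ v k + R * u k + n * w k := by
    intro k x hx
    have hx' : ‖x‖ ≤ R := by simpa using (Metric.mem_ball.1 hx).le
    refine (norm_wirtingerCLM_le _ _).trans (add_le_add ((norm_add_le _ _).trans
      (add_le_add (hvb k x hx') ?_)) ?_)
    · rw [norm_mul, RCLike.norm_conj]
      exact mul_le_mul hx' (hub k x hx') (norm_nonneg _) (by linarith)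
    · rw [norm_mul, norm_neg, Complex.norm_natCast]
      exact mul_le_mul_of_nonneg_left (hwb k x hx') (by positivity)
  have hsum : Summable fun k => v k + R * u k + n * w k :=
    (hv.add (hu.mul_left R)).add (hw.mul_left _)
  have hz : z ∈ Metric.ball (0 : ℂ) R := by simp [hR]
  have hder := hasFDerivAt_tsum_of_isPreconnected hsum Metric.isOpen_ball
    (convex_ball (0 : ℂ) R).isPreconnected (f := fun k x => c k * monomialRaised n k x)
    (f' := f') (fun k x _ => ?_) hbd hz (hc.hasSum n z).summable hz
  · refine hder.congr_fderiv ?_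
    have hs' : Summable fun k => f' k z := Summable.of_norm_bounded hsum fun k => hbd k z hz
    refine ContinuousLinearMap.ext fun y => ?_
    have h1 := hs'.hasSum.mapL (ContinuousLinearMap.apply ℝ ℂ y)
    simp only [ContinuousLinearMap.apply_apply] at h1
    refine h1.unique ?_
    simp only [hf', wirtingerCLM_apply]
    exact (((hc.hasSum (n + 1) z).add ((hc.hasSum n z).mul_left _)).mul_right y).add
      (((hc.hasSum (n - 1) z).mul_left _).mul_right _)
  · refine ((hasFDerivAt_monomialRaised n k x).const_mul (c k)).congr_fderiv ?_
    refine ContinuousLinearMap.ext fun y => ?_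
    simp only [hf', wirtingerCLM_apply, smul_apply, smul_eq_mul, monomialRaised_succ]
    ring

lemma raising_raisedSeries (hc : AdmissibleCoeff c) (n : ℕ) :
    raising (raisedSeries c n) = raisedSeries c (n + 1) := by
  funext z
  rw [raising, dz, (hc.hasFDerivAt_raisedSeries n z).fderiv]
  simp only [wirtingerCLM_apply, map_one, Complex.conj_I]
  linear_combination (-(1 / 2 : ℂ) * (raisedSeries c (n + 1) z +
    (starRingEnd ℂ) z * raisedSeries c n z + n * raisedSeries c (n - 1) z)) * Complex.I_mul_I

lemma raising_iterate_gef (hc : AdmissibleCoeff c) (n : ℕ) :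
    raising^[n] (gef c) = raisedSeries c n := by
  induction n with
  | zero => rfl
  | succ n ih => rw [Function.iterate_succ_apply', ih, hc.raising_raisedSeries]

end AdmissibleCoeff

/-! ### Weighted levels and the telescoping current -/

/-- The weighted Landau level field `e^{-|z|²/2} f_n(z)` written as a random series. -/
def weightedLevel (c : ℕ → ℂ) (n : ℕ) (z : ℂ) : ℂ :=
  (Real.exp (-‖z‖ ^ 2 / 2) : ℂ) * ((1 / (Real.sqrt (n.factorial : ℝ) : ℂ)) * raisedSeries c n z)

/-- The current `√n φ_n φ̄_{n-1}` whose increments are the `∂_z`-derivatives of `|φ_n|²`. -/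
def levelCurrent (c : ℕ → ℂ) (n : ℕ) (z : ℂ) : ℂ :=
  (Real.sqrt (n : ℝ) : ℂ) * (weightedLevel c n z * (starRingEnd ℂ) (weightedLevel c (n - 1) z))

lemma levelCurrent_zero (c : ℕ → ℂ) (z : ℂ) : levelCurrent c 0 z = 0 := by
  simp [levelCurrent]

/-- Clears the square roots through `√n / √(n! (n-1)!) = n / n!`, with both sides zero at `n = 0`.
-/
lemma levelCurrent_eq (c : ℕ → ℂ) (n : ℕ) (z : ℂ) :
    levelCurrent c n z = (Real.exp (-‖z‖ ^ 2) : ℂ) *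
      (raisedSeries c n z * (starRingEnd ℂ) (raisedSeries c (n - 1) z) * n / n.factorial) := by
  have he : (Real.exp (-‖z‖ ^ 2) : ℂ) =
      (Real.exp (-‖z‖ ^ 2 / 2) : ℂ) * (Real.exp (-‖z‖ ^ 2 / 2) : ℂ) := by
    rw [← Complex.ofReal_mul, ← Real.exp_add]
    congr 2
    ring
  rw [he]
  cases n with
  | zero => simp [levelCurrent]
  | succ n =>
    have h1 : (Real.sqrt (n.factorial : ℝ) : ℂ) ≠ 0 := by
      exact_mod_cast (sqrt_factorial_pos n).ne'
    have h2 : (Real.sqrt ((n + 1 : ℕ) : ℝ) : ℂ) ≠ 0 := by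
      exact_mod_cast (Real.sqrt_pos.2 (by positivity)).ne'
    have h3 := ofReal_sqrt_mul_self (n + 1)
    have h4 := ofReal_sqrt_mul_self n.factorial
    have h5 : (((n + 1).factorial : ℕ) : ℂ) = (Real.sqrt ((n + 1 : ℕ) : ℝ) : ℂ) *
        (Real.sqrt ((n + 1 : ℕ) : ℝ) : ℂ) *
        ((Real.sqrt (n.factorial : ℝ) : ℂ) * (Real.sqrt (n.factorial : ℝ) : ℂ)) := by
      rw [h3, h4, Nat.factorial_succ]; push_cast; ring
    simp only [levelCurrent, weightedLevel, map_mul, map_div₀, map_one, Complex.conj_ofReal,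
      Nat.add_sub_cancel]
    rw [h5, sqrt_factorial_succ, Complex.ofReal_mul, ← h3]
    field_simp

namespace AdmissibleCoeff

variable {c : ℕ → ℂ}

lemma landauField_eq (hc : AdmissibleCoeff c) (n : ℕ) (z : ℂ) :
    (Real.exp (-‖z‖ ^ 2 / 2) : ℂ) * landauField c n z = weightedLevel c n z := by
  rw [landauField, hc.raising_iterate_gef, weightedLevel]

lemma averagedField_eq (hc : AdmissibleCoeff c) (N : ℕ) :
    averagedField c N = fun z => (1 / (N : ℝ)) * ∑ n ∈ Finset.range N, ‖weightedLevel c n z‖ ^ 2 := by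
  funext z
  rw [averagedField]
  simp only [hc.landauField_eq]

lemma hasSum_weightedLevel (hc : AdmissibleCoeff c) (n : ℕ) (z : ℂ) :
    HasSum (fun k => c k * displacement n k z) (weightedLevel c n z) := by
  have h := ((hc.hasSum n z).mul_left (1 / (Real.sqrt (n.factorial : ℝ) : ℂ))).mul_left
    (Real.exp (-‖z‖ ^ 2 / 2) : ℂ)
  have he : (fun k => c k * displacement n k z) = fun k => (Real.exp (-‖z‖ ^ 2 / 2) : ℂ) *
      ((1 / (Real.sqrt (n.factorial : ℝ) : ℂ)) * (c k * monomialRaised n k z)) := by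
    funext k
    rw [displacement]
    ring
  rw [he]
  exact h

/-- The derivative of the Gaussian weight cancels the `z̄` term in `∂_z f_n`. What is left is
`f_{n+1} f̄_n`, giving `J_{n+1}`, and the conjugate of `∂_z̄ f_n`, giving `-J_n`. -/
lemma hasFDerivAt_norm_weightedLevel_sq (hc : AdmissibleCoeff c) (n : ℕ) (z : ℂ) :
    HasFDerivAt (fun z => ‖weightedLevel c n z‖ ^ 2)
      (reCLM₂ (levelCurrent c (n + 1) z - levelCurrent c n z)) z := by
  have h := (hasFDerivAt_exp_mul_normSq (hc.hasFDerivAt_raisedSeries n z)).mul_const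
    ((n.factorial : ℝ)⁻¹)
  simp only [weightedLevel, norm_weight_sq]
  simp only [div_eq_mul_inv]
  refine h.congr_fderiv ?_
  have h1 : ((n.factorial : ℕ) : ℂ) ≠ 0 := by exact_mod_cast n.factorial_ne_zero
  have h2 : ((n : ℂ) + 1) ≠ 0 := by exact_mod_cast n.succ_ne_zero
  have h3 : levelCurrent c (n + 1) z - levelCurrent c n z = ((n.factorial : ℝ)⁻¹ : ℝ) *
      ((Real.exp (-‖z‖ ^ 2) : ℂ) * ((raisedSeries c (n + 1) z + (starRingEnd ℂ) z *
        raisedSeries c n z) * (starRingEnd ℂ) (raisedSeries c n z) + raisedSeries c n z *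
        (starRingEnd ℂ) (-(n : ℂ) * raisedSeries c (n - 1) z)
        - (starRingEnd ℂ) z * (raisedSeries c n z * (starRingEnd ℂ) (raisedSeries c n z)))) := by
    rw [levelCurrent_eq, levelCurrent_eq, Nat.factorial_succ, Nat.add_sub_cancel]
    simp only [map_mul, map_neg, map_natCast, Complex.ofReal_inv, Complex.ofReal_natCast]
    push_cast
    field_simp
    ring
  rw [h3, reCLM₂_ofReal_mul (n.factorial : ℝ)⁻¹]

lemma hasFDerivAt_averagedField (hc : AdmissibleCoeff c) (N : ℕ) (z : ℂ) :
    HasFDerivAt (averagedField c N) ((1 / (N : ℝ)) • reCLM₂ (levelCurrent c N z)) z := by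
  rw [hc.averagedField_eq]
  have h := (HasFDerivAt.fun_sum (u := Finset.range N) fun n _ =>
    hc.hasFDerivAt_norm_weightedLevel_sq n z).const_mul (1 / (N : ℝ))
  refine h.congr_fderiv ?_
  rw [← reCLM₂_sum, Finset.sum_range_sub (fun n => levelCurrent c n z), levelCurrent_zero,
    sub_zero]

/-- Polynomial growth in `n` of the weighted Landau level fields. -/
lemma norm_weightedLevel_sq_le (hc : AdmissibleCoeff c) (n : ℕ) (z : ℂ) :
    ‖weightedLevel c n z‖ ^ 2 ≤ (∑' k : ℕ, ‖c k‖ ^ 2 / ((k : ℝ) + 1) ^ 2) *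
      (4 * ((1 + ‖z‖ ^ 2) * (2 * n + 2)) ^ 2) := by
  have ht := ((hc.hasSum_weightedLevel n z).tendsto_sum_nat.norm).pow 2
  refine le_of_tendsto ht (Eventually.of_forall fun K => ?_)
  calc ‖∑ k ∈ Finset.range K, c k * displacement n k z‖ ^ 2
      -- Cauchy–Schwarz with weight `k + 1`, pairing admissibility of `c` with the second moment of
      -- the row.
      ≤ (∑ k ∈ Finset.range K, (‖c k‖ / ((k : ℝ) + 1)) *
          (((k : ℝ) + 1) * ‖displacement n k z‖)) ^ 2 := by
        gcongr
        refine (norm_sum_le _ _).trans (le_of_eq (Finset.sum_congr rfl fun k _ => ?_))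
        rw [norm_mul]
        field_simp
    _ ≤ (∑ k ∈ Finset.range K, (‖c k‖ / ((k : ℝ) + 1)) ^ 2) *
        ∑ k ∈ Finset.range K, (((k : ℝ) + 1) * ‖displacement n k z‖) ^ 2 :=
        Finset.sum_mul_sq_le_sq_mul_sq _ _ _
    _ ≤ _ := by
        simp only [mul_pow _ ‖displacement _ _ _‖, div_pow]
        refine mul_le_mul (hc.sum_le_tsum _ fun _ _ => by positivity)
          (sum_succ_sq_mul_norm_displacement_sq_le n K z)
          (Finset.sum_nonneg fun _ _ => by positivity) (tsum_nonneg fun _ => by positivity)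

lemma averagedField_apply_zero (hc : AdmissibleCoeff c) (N : ℕ) :
    averagedField c N 0 = (∑ n ∈ Finset.range N, ‖c n‖ ^ 2) / N := by
  have h : ∀ n, weightedLevel c n 0 = c n := by
    intro n
    have h1 : (Real.sqrt (n.factorial : ℝ) : ℂ) ≠ 0 := by
      exact_mod_cast (sqrt_factorial_pos n).ne'
    rw [weightedLevel, raisedSeries, tsum_eq_single n]
    · rw [monomialRaised_apply_zero]
      simp
      field_simp
    · intro k hk
      rw [monomialRaised_apply_zero, if_neg hk.symm, mul_zero]
  rw [hc.averagedField_eq]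
  simp only [h]
  ring

end AdmissibleCoeff

/-! ### From Lipschitz bounds to Hölder convergence -/

/-- Interpolation: `‖z - w‖ = ‖z - w‖^{1-α} ‖z - w‖^α`, and the first factor is at most
`(2R)^{1-α}`. -/
lemma holderSeminorm_le_of_lipschitz {α C R : ℝ} (hα : α < 1) (hC : 0 ≤ C)
    {K : Set ℂ} (hK : K ⊆ Metric.closedBall 0 R) {u : ℂ → ℝ}
    (hu : ∀ z ∈ K, ∀ w ∈ K, |u z - u w| ≤ C * ‖z - w‖) :
    holderSeminorm α K u ≤ ENNReal.ofReal (C * (2 * R) ^ (1 - α)) := by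
  refine iSup₂_le fun z hz => iSup₂_le fun w hw => iSup_le fun hne => ?_
  refine ENNReal.ofReal_le_ofReal ?_
  have hpos : 0 < ‖z - w‖ := norm_pos_iff.2 (sub_ne_zero.2 hne)
  have hz' : ‖z‖ ≤ R := by simpa using hK hz
  have hw' : ‖w‖ ≤ R := by simpa using hK hw
  have hd : ‖z - w‖ ≤ 2 * R := (norm_sub_le _ _).trans (by linarith)
  rw [div_le_iff₀ (by positivity)]
  calc |u z - u w| ≤ C * ‖z - w‖ := hu z hz w hw
    _ = C * ‖z - w‖ ^ (1 - α) * ‖z - w‖ ^ α := by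
        rw [mul_assoc, ← Real.rpow_add hpos]
        simp
    _ ≤ _ := by gcongr

/-- Local Lipschitz bounds tending to zero together with convergence at one point give
convergence in the Hölder spaces. -/
lemma tendstoHolder_of_lipschitz {α R : ℝ} (hα : α < 1) (hR : 0 ≤ R)
    {K : Set ℂ} (hK : K ⊆ Metric.closedBall 0 R) {u : ℕ → ℂ → ℝ} {L : ℕ → ℝ}
    (hL : Tendsto L atTop (𝓝 0))
    (hlip : ∀ N, ∃ C, 0 ≤ C ∧ ∀ z ∈ Metric.closedBall (0 : ℂ) R, ∀ w ∈ Metric.closedBall (0 : ℂ) R,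
      |u N z - u N w| ≤ C * ‖z - w‖)
    (hlipL : ∀ᶠ N in atTop, 0 ≤ L N ∧ ∀ z ∈ Metric.closedBall (0 : ℂ) R,
      ∀ w ∈ Metric.closedBall (0 : ℂ) R, |u N z - u N w| ≤ L N * ‖z - w‖)
    {a : ℝ} (h0 : Tendsto (fun N => u N 0) atTop (𝓝 a)) :
    TendstoHolder α K u (fun _ => a) := by
  refine ⟨fun N => ?_, ⟨continuousOn_const, ?_⟩, ?_⟩
  · obtain ⟨C, hC, h⟩ := hlip N
    refine ⟨?_, (holderSeminorm_le_of_lipschitz hα hC hK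
      fun z hz w hw => h z (hK hz) w (hK hw)).trans_lt ENNReal.ofReal_lt_top⟩
    have : LipschitzOnWith C.toNNReal (u N) K := LipschitzOnWith.of_dist_le_mul fun z hz w hw => by
      rw [Real.dist_eq, dist_eq_norm, Real.coe_toNNReal _ hC]
      exact h z (hK hz) w (hK hw)
    exact this.continuousOn
  · refine (holderSeminorm_le_of_lipschitz (C := 0) hα le_rfl hK fun z _ w _ => ?_).trans_lt
      ENNReal.ofReal_lt_top
    simp
  · have hlim : Tendsto (fun N => ENNReal.ofReal (|u N 0 - a| + L N * R) +
        ENNReal.ofReal (L N * (2 * R) ^ (1 - α))) atTop (𝓝 0) := by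
      have h1 : Tendsto (fun N => |u N 0 - a| + L N * R) atTop (𝓝 0) := by
        simpa using ((h0.sub_const a).abs).add (hL.mul_const R)
      have h2 : Tendsto (fun N => L N * (2 * R) ^ (1 - α)) atTop (𝓝 0) := by
        simpa using hL.mul_const ((2 * R) ^ (1 - α))
      simpa using (ENNReal.tendsto_ofReal h1).add (ENNReal.tendsto_ofReal h2)
    refine tendsto_of_tendsto_of_tendsto_of_le_of_le' tendsto_const_nhds hlim
      (Eventually.of_forall fun _ => zero_le) ?_
    filter_upwards [hlipL] with N ⟨hL0, hN⟩
    refine add_le_add (iSup₂_le fun z hz => ENNReal.ofReal_le_ofReal ?_)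
      (holderSeminorm_le_of_lipschitz hα hL0 hK fun z hz w hw => ?_)
    · have h1 := hN z (hK hz) 0 (Metric.mem_closedBall_self hR)
      have hz' : ‖z - 0‖ ≤ R := by simpa using hK hz
      have h2 := mul_le_mul_of_nonneg_left hz' hL0
      calc |u N z - a| ≤ |u N z - u N 0| + |u N 0 - a| := abs_sub_le _ _ _
        _ ≤ _ := by linarith
    · rw [sub_sub_sub_cancel_right]
      exact hN z (hK hz) w (hK hw)

/-! ### Lattices and the passage from lattice points to discs -/

/-- The point of the square lattice of mesh `1/m` with integer coordinates `p`. -/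
def gridPoint (m : ℕ) (p : ℤ × ℤ) : ℂ := ⟨p.1 / m, p.2 / m⟩

/-- The coordinates of the lattice points of mesh `1/m` in the square of half-side `R`. -/
def gridIndex (R m : ℕ) : Finset (ℤ × ℤ) :=
  Finset.Icc (-(R * m : ℤ)) (R * m) ×ˢ Finset.Icc (-(R * m : ℤ)) (R * m)

lemma card_gridIndex (R m : ℕ) : (gridIndex R m).card = (2 * (R * m) + 1) ^ 2 := by
  rw [gridIndex, Finset.card_product, Int.card_Icc, sq]
  have h : (((R : ℤ) * m) + 1 - -((R : ℤ) * m)).toNat = 2 * (R * m) + 1 := by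
    have h1 : (((R : ℤ) * m) + 1 - -((R : ℤ) * m)) = ((2 * (R * m) + 1 : ℕ) : ℤ) := by
      push_cast
      ring
    rw [h1, Int.toNat_natCast]
  rw [h]

lemma exists_floor_div {R m : ℕ} (hm : 0 < m) {x : ℝ} (hx : |x| ≤ R) :
    ∃ i ∈ Finset.Icc (-(R * m : ℤ)) (R * m), |x - i / m| ≤ 1 / m ∧ |(i : ℝ) / m| ≤ R := by
  have hm' : (0 : ℝ) < m := by exact_mod_cast hm
  obtain ⟨h1, h2⟩ := abs_le.1 hx
  have hf1 := Int.floor_le (x * m)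
  have hf2 := Int.lt_floor_add_one (x * m)
  have hlo : -(R * m : ℤ) ≤ ⌊x * m⌋ := by
    rw [Int.le_floor]
    push_cast
    nlinarith
  have hhi : ⌊x * m⌋ ≤ (R * m : ℤ) := by
    have : (⌊x * m⌋ : ℝ) ≤ R * m := hf1.trans (by nlinarith)
    exact_mod_cast this
  refine ⟨⌊x * m⌋, Finset.mem_Icc.2 ⟨hlo, hhi⟩, ?_, ?_⟩
  · rw [show x - (⌊x * m⌋ : ℝ) / m = (x * m - ⌊x * m⌋) / m by field_simp, abs_div,
      abs_of_pos hm']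
    gcongr
    rw [abs_le]
    constructor <;> linarith
  · rw [abs_div, abs_of_pos hm', div_le_iff₀ hm', abs_le]
    constructor
    · have : ((-(R * m : ℤ) : ℤ) : ℝ) ≤ (⌊x * m⌋ : ℝ) := by exact_mod_cast hlo
      push_cast at this
      linarith
    · have : (⌊x * m⌋ : ℝ) ≤ ((R * m : ℤ) : ℝ) := by exact_mod_cast hhi
      push_cast at this
      linarith

lemma exists_gridPoint {R m : ℕ} (hm : 0 < m) {z : ℂ} (hz : ‖z‖ ≤ R) :
    ∃ p ∈ gridIndex R m, ‖z - gridPoint m p‖ ≤ 2 / m ∧ ‖gridPoint m p‖ ≤ 2 * R := by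
  obtain ⟨i, hi, hi1, hi2⟩ := exists_floor_div hm ((Complex.abs_re_le_norm z).trans hz)
  obtain ⟨j, hj, hj1, hj2⟩ := exists_floor_div hm ((Complex.abs_im_le_norm z).trans hz)
  refine ⟨(i, j), Finset.mem_product.2 ⟨hi, hj⟩, ?_, ?_⟩
  · refine (Complex.norm_le_abs_re_add_abs_im _).trans ?_
    calc _ ≤ (1 : ℝ) / m + 1 / m := add_le_add hi1 hj1
      _ = _ := by ring
  · refine (Complex.norm_le_abs_re_add_abs_im _).trans ?_
    calc _ ≤ (R : ℝ) + R := add_le_add hi2 hj2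
      _ = _ := by ring

lemma tendsto_log_div_sqrt (B : ℝ) :
    Tendsto (fun N : ℕ => 2 * (32 * Real.log (N + 2) + B) / Real.sqrt N) atTop (𝓝 0) := by
  have h1 : Tendsto (fun N : ℕ => ((N : ℝ) + 2)) atTop atTop :=
    tendsto_atTop_add_const_right _ _ tendsto_natCast_atTop_atTop
  have h2 : Tendsto (fun x : ℝ => Real.log x / Real.sqrt x) atTop (𝓝 0) := by
    have := (isLittleO_log_rpow_atTop (r := 1 / 2) (by norm_num)).tendsto_div_nhds_zero
    simpa [Real.sqrt_eq_rpow] using this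
  have h3 : Tendsto (fun x : ℝ => 1 / Real.sqrt x) atTop (𝓝 0) := by
    simpa [Function.comp_def] using tendsto_inv_atTop_zero.comp Real.tendsto_sqrt_atTop
  have h4 : Tendsto (fun N : ℕ => 128 * (Real.log ((N : ℝ) + 2) / Real.sqrt ((N : ℝ) + 2)) +
      4 * |B| * (1 / Real.sqrt ((N : ℝ) + 2))) atTop (𝓝 0) := by
    simpa using ((h2.comp h1).const_mul 128).add ((h3.comp h1).const_mul (4 * |B|))
  refine squeeze_zero_norm' ?_ h4
  filter_upwards [eventually_ge_atTop 1] with N hN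
  have hN' : (1 : ℝ) ≤ N := by exact_mod_cast hN
  have hs : 0 < Real.sqrt N := Real.sqrt_pos.2 (by linarith)
  have hs2 : 0 < Real.sqrt ((N : ℝ) + 2) := Real.sqrt_pos.2 (by linarith)
  have hcmp : Real.sqrt ((N : ℝ) + 2) ≤ 2 * Real.sqrt N := by
    rw [Real.sqrt_le_left (by positivity), mul_pow, Real.sq_sqrt (by linarith)]
    linarith
  have hl : 0 ≤ Real.log ((N : ℝ) + 2) := Real.log_nonneg (by linarith)
  have hinv : 1 / Real.sqrt N ≤ 2 * (1 / Real.sqrt ((N : ℝ) + 2)) := by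
    rw [mul_one_div, div_le_div_iff₀ hs hs2]
    linarith
  have habs : |2 * (32 * Real.log (N + 2) + B)| ≤ 2 * (32 * Real.log (N + 2) + |B|) := by
    rw [abs_mul, abs_two]
    gcongr
    refine (abs_add_le _ _).trans ?_
    rw [abs_of_nonneg (by positivity)]
  rw [norm_div, Real.norm_of_nonneg hs.le, Real.norm_eq_abs]
  calc _ ≤ 2 * (32 * Real.log (N + 2) + |B|) * (1 / Real.sqrt N) := by
        rw [mul_one_div]; gcongr
    _ ≤ 2 * (32 * Real.log (N + 2) + |B|) * (2 * (1 / Real.sqrt ((N : ℝ) + 2))) := by gcongr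
    _ = _ := by ring

lemma norm_levelCurrent_le {c : ℕ → ℂ} {n : ℕ} {z : ℂ} {M : ℝ}
    (h1 : ‖weightedLevel c n z‖ ^ 2 ≤ M) (h2 : ‖weightedLevel c (n - 1) z‖ ^ 2 ≤ M) :
    ‖levelCurrent c n z‖ ≤ Real.sqrt n * M := by
  rw [levelCurrent, norm_mul, norm_mul, RCLike.norm_conj, Complex.norm_real,
    Real.norm_of_nonneg (Real.sqrt_nonneg _)]
  gcongr
  nlinarith [sq_nonneg (‖weightedLevel c n z‖ - ‖weightedLevel c (n - 1) z‖)]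

namespace AdmissibleCoeff

variable {c : ℕ → ℂ}

/-- Control of the weighted level fields on fine lattices extends to discs. -/
lemma exists_norm_weightedLevel_sq_le_of_grid (hc : AdmissibleCoeff c) (R : ℕ) {a : ℕ → ℝ}
    (hgrid : ∀ᶠ n : ℕ in atTop, ∀ p ∈ gridIndex R ((n + 2) ^ 3),
      ‖weightedLevel c n (gridPoint ((n + 2) ^ 3) p)‖ ^ 2 ≤ a n) :
    ∃ B : ℝ, 0 ≤ B ∧ ∀ᶠ n : ℕ in atTop, ∀ z : ℂ, ‖z‖ ≤ R → ‖weightedLevel c n z‖ ^ 2 ≤ a n + B := by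
  set A : ℝ := ∑' k : ℕ, ‖c k‖ ^ 2 / ((k : ℝ) + 1) ^ 2 with hA
  have hA0 : 0 ≤ A := tsum_nonneg fun _ => by positivity
  -- The radius is `2R` because lattice points approximating the disc lie in a square and may leave
  -- the disc itself.
  set B : ℝ := A * (16 * (1 + (2 * R) ^ 2) ^ 2) with hB
  have hB0 : 0 ≤ B := by positivity
  have hbd : ∀ (n j : ℕ) (z : ℂ), j ≤ n + 1 → ‖z‖ ≤ 2 * R →
      ‖weightedLevel c j z‖ ^ 2 ≤ B * ((n : ℝ) + 2) ^ 2 := by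
    intro n j z hj hz
    refine (hc.norm_weightedLevel_sq_le j z).trans ?_
    have hj' : (j : ℝ) ≤ n + 1 := by exact_mod_cast hj
    calc A * (4 * ((1 + ‖z‖ ^ 2) * (2 * j + 2)) ^ 2)
        ≤ A * (4 * ((1 + (2 * R) ^ 2) * (2 * (n + 1) + 2)) ^ 2) := by gcongr
      _ = _ := by rw [hB]; ring
  refine ⟨8 * B, by positivity, ?_⟩
  filter_upwards [hgrid] with n hn z hz
  set m : ℕ := (n + 2) ^ 3 with hm
  have hm0 : 0 < m := by positivity
  have hm' : (m : ℝ) = ((n : ℝ) + 2) ^ 3 := by rw [hm]; push_cast; ring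
  have hmpos : (0 : ℝ) < m := by exact_mod_cast hm0
  obtain ⟨p, hp, hzp, hpR⟩ := exists_gridPoint hm0 hz
  -- A factor `n + 2` from `√j` and `(n + 2)²` from the fields match the mesh `1/m`, so the
  -- oscillation between a point and its lattice neighbour is bounded independently of `n`.
  have hcur : ∀ j ≤ n + 1, ∀ x : ℂ, ‖x‖ ≤ 2 * R → ‖levelCurrent c j x‖ ≤ B * m := by
    intro j hj x hx
    refine (norm_levelCurrent_le (hbd n j x hj hx) (hbd n (j - 1) x (by omega) hx)).trans ?_
    have hs : Real.sqrt j ≤ (n : ℝ) + 2 := by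
      have hj' : (j : ℝ) ≤ n + 1 := by exact_mod_cast hj
      rw [Real.sqrt_le_left (by positivity)]
      nlinarith [(Nat.cast_nonneg n : (0 : ℝ) ≤ n)]
    calc _ ≤ ((n : ℝ) + 2) * (B * ((n : ℝ) + 2) ^ 2) := by gcongr
      _ = _ := by rw [hm']; ring
  have hlip : ‖‖weightedLevel c n z‖ ^ 2 - ‖weightedLevel c n (gridPoint m p)‖ ^ 2‖ ≤
      4 * (B * m) * ‖z - gridPoint m p‖ := by
    refine (convex_closedBall (0 : ℂ) (2 * R)).norm_image_sub_le_of_norm_hasFDerivWithin_le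
      (f := fun z => ‖weightedLevel c n z‖ ^ 2)
      (fun x _ => (hc.hasFDerivAt_norm_weightedLevel_sq n x).hasFDerivWithinAt)
      (fun x hx => ?_) (by simpa using hpR) ?_
    · have hx' : ‖x‖ ≤ 2 * R := by simpa using hx
      have h1 := hcur (n + 1) le_rfl x hx'
      have h2 := hcur n (by omega) x hx'
      have h3 := norm_sub_le (levelCurrent c (n + 1) x) (levelCurrent c n x)
      refine (norm_reCLM₂_le _).trans ?_
      linarith
    · have : (0 : ℝ) ≤ R := by positivity
      simp only [mem_closedBall_zero_iff]
      linarith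
  have h1 := (le_abs_self _).trans hlip
  have h2 := hn p hp
  have h3 : 4 * (B * m) * ‖z - gridPoint m p‖ ≤ 8 * B := by
    calc _ ≤ 4 * (B * m) * (2 / m) := by gcongr
      _ = 8 * B := by field_simp; ring
  linarith

/-- The gain comes from telescoping: the gradient is `1/N` times one current of size `√N M`, rather
than an average of `N` gradients. -/
lemma averagedField_sub_le (hc : AdmissibleCoeff c) {R M : ℝ} {N : ℕ}
    (h : ∀ z : ℂ, ‖z‖ ≤ R → ‖weightedLevel c N z‖ ^ 2 ≤ M ∧ ‖weightedLevel c (N - 1) z‖ ^ 2 ≤ M)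
    {z w : ℂ} (hz : z ∈ Metric.closedBall (0 : ℂ) R) (hw : w ∈ Metric.closedBall (0 : ℂ) R) :
    |averagedField c N z - averagedField c N w| ≤ (2 * M / Real.sqrt N) * ‖z - w‖ := by
  refine (convex_closedBall (0 : ℂ) R).norm_image_sub_le_of_norm_hasFDerivWithin_le
    (fun x _ => (hc.hasFDerivAt_averagedField N x).hasFDerivWithinAt) (fun x hx => ?_) hw hz
  have hx' : ‖x‖ ≤ R := by simpa using hx
  have h1 := norm_levelCurrent_le (h x hx').1 (h x hx').2
  rw [norm_smul, Real.norm_of_nonneg (by positivity)]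
  rcases N.eq_zero_or_pos with rfl | hN
  · simp
  have hN' : (0 : ℝ) < N := by exact_mod_cast hN
  have hs : 0 < Real.sqrt N := Real.sqrt_pos.2 hN'
  have hss : Real.sqrt N * Real.sqrt N = N := Real.mul_self_sqrt hN'.le
  calc 1 / (N : ℝ) * ‖reCLM₂ (levelCurrent c N x)‖ ≤ 1 / (N : ℝ) * (2 * (Real.sqrt N * M)) := by
        gcongr
        exact (norm_reCLM₂_le _).trans (by gcongr)
    _ = _ := by
        generalize Real.sqrt N = s at hs hss
        rw [← hss]
        field_simp

/-- The deterministic part of the theorem: logarithmic bounds on lattices and the law of large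
numbers at the origin imply convergence in Hölder spaces. -/
lemma tendstoHolder (hc : AdmissibleCoeff c) (R : ℕ) {α : ℝ} (hα : α < 1) {K : Set ℂ}
    (hK : K ⊆ Metric.closedBall 0 R)
    (hgrid : ∀ᶠ n : ℕ in atTop, ∀ p ∈ gridIndex R ((n + 2) ^ 3),
      ‖weightedLevel c n (gridPoint ((n + 2) ^ 3) p)‖ ^ 2 ≤ 32 * Real.log (n + 2))
    (h0 : Tendsto (fun N : ℕ => (∑ n ∈ Finset.range N, ‖c n‖ ^ 2) / N) atTop (𝓝 1)) :
    TendstoHolder α K (averagedField c) (fun _ => 1) := by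
  obtain ⟨B, hB0, hB⟩ := hc.exists_norm_weightedLevel_sq_le_of_grid R hgrid
  refine tendstoHolder_of_lipschitz hα (R := R) (by positivity) hK (tendsto_log_div_sqrt B)
    (fun N => ?_) ?_ (by simpa only [hc.averagedField_apply_zero] using h0)
  · set M : ℝ := (∑' k : ℕ, ‖c k‖ ^ 2 / ((k : ℝ) + 1) ^ 2) *
      (4 * ((1 + (R : ℝ) ^ 2) * (2 * N + 2)) ^ 2) with hM
    have hA0 : 0 ≤ ∑' k : ℕ, ‖c k‖ ^ 2 / ((k : ℝ) + 1) ^ 2 := tsum_nonneg fun _ => by positivity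
    have hbd : ∀ j ≤ N, ∀ z : ℂ, ‖z‖ ≤ R → ‖weightedLevel c j z‖ ^ 2 ≤ M := by
      intro j hj z hz
      refine (hc.norm_weightedLevel_sq_le j z).trans ?_
      have hj' : (j : ℝ) ≤ N := by exact_mod_cast hj
      rw [hM]
      gcongr
    exact ⟨2 * M / Real.sqrt N, by positivity, fun z hz w hw => hc.averagedField_sub_le
      (fun x hx => ⟨hbd N le_rfl x hx, hbd (N - 1) (by omega) x hx⟩) hz hw⟩
  -- The current `J_N` involves levels `N` and `N - 1`, so the eventual bound is also needed at the
  -- shifted index.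
  · have hB' := (tendsto_sub_atTop_nat 1).eventually hB
    filter_upwards [hB, hB'] with N h1 h2
    have hl : 0 ≤ Real.log ((N : ℝ) + 2) :=
      Real.log_nonneg (by linarith [(Nat.cast_nonneg N : (0 : ℝ) ≤ N)])
    refine ⟨by positivity, fun z hz w hw => hc.averagedField_sub_le
      (fun x hx => ⟨h1 x hx, (h2 x hx).trans ?_⟩) hz hw⟩
    gcongr
    omega

end AdmissibleCoeff

/-! ### Sub-Gaussian estimates for the complex Gaussian law -/

lemma measurable_complex_mk : Measurable fun p : ℝ × ℝ => (⟨p.1, p.2⟩ : ℂ) :=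
  Complex.measurableEquivRealProd.symm.measurable

lemma map_re_stdComplexGaussian : stdComplexGaussian.map Complex.re = gaussianReal 0 (1 / 2) := by
  rw [stdComplexGaussian, Measure.map_map Complex.measurable_re measurable_complex_mk]
  exact (measurePreserving_fst (μ := gaussianReal 0 (1 / 2)) (ν := gaussianReal 0 (1 / 2))).map_eq

lemma map_im_stdComplexGaussian : stdComplexGaussian.map Complex.im = gaussianReal 0 (1 / 2) := by
  rw [stdComplexGaussian, Measure.map_map Complex.measurable_im measurable_complex_mk]
  exact (measurePreserving_snd (μ := gaussianReal 0 (1 / 2)) (ν := gaussianReal 0 (1 / 2))).map_eq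

section SubGaussian

variable {Ω : Type*} [MeasurableSpace Ω] {P : Measure Ω}

lemma hasSubgaussianMGF_mono {X : Ω → ℝ} {c d : NNReal} (h : HasSubgaussianMGF X c P)
    (hcd : c ≤ d) : HasSubgaussianMGF X d P :=
  ⟨h.integrable_exp_mul, fun t => (h.mgf_le t).trans (by gcongr)⟩

lemma hasSubgaussianMGF_of_hasLaw_gaussianReal {X : Ω → ℝ} {v : NNReal}
    (hX : HasLaw X (gaussianReal 0 v) P) : HasSubgaussianMGF X v P := by
  refine ⟨fun t => ?_, fun t => ?_⟩
  · have h := integrable_exp_mul_gaussianReal (μ := 0) (v := v) t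
    rw [← hX.map_eq] at h
    exact h.comp_aemeasurable hX.aemeasurable
  · rw [mgf_gaussianReal hX.map_eq, zero_mul, zero_add]

variable {Z : Ω → ℂ}

lemma hasLaw_re (hZ : HasLaw Z stdComplexGaussian P) :
    HasLaw (fun ω => (Z ω).re) (gaussianReal 0 (1 / 2)) P :=
  HasLaw.comp ⟨Complex.measurable_re.aemeasurable, map_re_stdComplexGaussian⟩ hZ

lemma hasLaw_im (hZ : HasLaw Z stdComplexGaussian P) :
    HasLaw (fun ω => (Z ω).im) (gaussianReal 0 (1 / 2)) P :=
  HasLaw.comp ⟨Complex.measurable_im.aemeasurable, map_im_stdComplexGaussian⟩ hZ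

/-- The real and imaginary contributions are added without using their independence, which gives the
proxy `(√x + √y)² ≤ 2(x + y) = ‖a‖²`: twice the true variance, and sufficient for the tail bounds.
-/
lemma hasSubgaussianMGF_re_mul (hZ : HasLaw Z stdComplexGaussian P) (a : ℂ) :
    HasSubgaussianMGF (fun ω => (Z ω * a).re) (‖a‖₊ ^ 2) P := by
  have h1 := gaussianReal_const_mul (hasLaw_re hZ) a.re
  have h2 := gaussianReal_const_mul (hasLaw_im hZ) (-a.im)
  rw [mul_zero] at h1 h2
  have h := (hasSubgaussianMGF_of_hasLaw_gaussianReal h1).add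
    (hasSubgaussianMGF_of_hasLaw_gaussianReal h2)
  refine hasSubgaussianMGF_mono (h.congr (ae_of_all _ fun ω => ?_)) ?_
  · simp only [Complex.mul_re]
    ring
  · set x : NNReal := .mk (a.re ^ 2) (sq_nonneg _) * (1 / 2)
    set y : NNReal := .mk ((-a.im) ^ 2) (sq_nonneg _) * (1 / 2)
    have hxy : ‖a‖₊ ^ 2 = 2 * (x + y) := by
      apply NNReal.coe_injective
      simp only [x, y]
      push_cast
      rw [← Complex.normSq_eq_norm_sq, Complex.normSq_apply]
      simp
      ring
    rw [hxy]
    calc (x.sqrt + y.sqrt) ^ 2 ≤ 2 * (x.sqrt ^ 2 + y.sqrt ^ 2) := add_sq_le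
      _ = _ := by simp

lemma integrable_norm_sq (hZ : HasLaw Z stdComplexGaussian P) :
    Integrable (fun ω => ‖Z ω‖ ^ 2) P := by
  have h1 := ((hasSubgaussianMGF_of_hasLaw_gaussianReal (hasLaw_re hZ)).memLp 2).integrable_sq
  have h2 := ((hasSubgaussianMGF_of_hasLaw_gaussianReal (hasLaw_im hZ)).memLp 2).integrable_sq
  refine (h1.add h2).congr (ae_of_all _ fun ω => ?_)
  simp only [Pi.add_apply]
  rw [← Complex.normSq_eq_norm_sq, Complex.normSq_apply]
  ring

lemma integral_sq_of_hasLaw_gaussianReal {X : Ω → ℝ} {v : NNReal}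
    (hX : HasLaw X (gaussianReal 0 v) P) : ∫ ω, X ω ^ 2 ∂P = v := by
  rw [← variance_of_integral_eq_zero hX.aemeasurable (by rw [hX.integral_eq]; simp),
    hX.variance_eq, variance_id_gaussianReal]

lemma integral_norm_sq (hZ : HasLaw Z stdComplexGaussian P) : ∫ ω, ‖Z ω‖ ^ 2 ∂P = 1 := by
  have h1 := ((hasSubgaussianMGF_of_hasLaw_gaussianReal (hasLaw_re hZ)).memLp 2).integrable_sq
  have h2 := ((hasSubgaussianMGF_of_hasLaw_gaussianReal (hasLaw_im hZ)).memLp 2).integrable_sq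
  have h : ∀ ω, ‖Z ω‖ ^ 2 = (Z ω).re ^ 2 + (Z ω).im ^ 2 := fun ω => by
    rw [← Complex.normSq_eq_norm_sq, Complex.normSq_apply]
    ring
  simp only [h]
  rw [integral_add h1 h2, integral_sq_of_hasLaw_gaussianReal (hasLaw_re hZ),
    integral_sq_of_hasLaw_gaussianReal (hasLaw_im hZ)]
  norm_num

end SubGaussian

/-! ### Almost sure properties of the Gaussian coefficients -/

section IID

variable {Ω : Type*} [MeasurableSpace Ω] {P : Measure Ω} {ζ : ℕ → Ω → ℂ}

/-- The expectation of the defining series is `∑ 1/(k+1)²`, which is finite. No independence is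
involved. -/
lemma ae_admissibleCoeff (hlaw : ∀ k, HasLaw (ζ k) stdComplexGaussian P) :
    ∀ᵐ ω ∂P, AdmissibleCoeff (fun k => ζ k ω) := by
  have hint : ∀ k : ℕ, Integrable (fun ω => ‖ζ k ω‖ ^ 2 / ((k : ℝ) + 1) ^ 2) P := fun k =>
    (integrable_norm_sq (hlaw k)).div_const _
  have hlint : ∀ k : ℕ, ∫⁻ ω, ENNReal.ofReal (‖ζ k ω‖ ^ 2 / ((k : ℝ) + 1) ^ 2) ∂P =
      ENNReal.ofReal (1 / ((k : ℝ) + 1) ^ 2) := by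
    intro k
    rw [← ofReal_integral_eq_lintegral_ofReal (hint k) (ae_of_all _ fun _ => by positivity),
      integral_div, integral_norm_sq (hlaw k)]
  have hsum : Summable fun k : ℕ => 1 / ((k : ℝ) + 1) ^ 2 := by
    have := (summable_nat_add_iff 1).2 (Real.summable_one_div_nat_pow.2 (one_lt_two))
    simpa using this
  have hfin : ∫⁻ ω, ∑' k : ℕ, ENNReal.ofReal (‖ζ k ω‖ ^ 2 / ((k : ℝ) + 1) ^ 2) ∂P ≠ ∞ := by
    rw [lintegral_tsum fun k => (hint k).aemeasurable.ennreal_ofReal]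
    simp only [hlint]
    exact hsum.tsum_ofReal_ne_top
  have hmeas : AEMeasurable
      (fun ω => ∑' k : ℕ, ENNReal.ofReal (‖ζ k ω‖ ^ 2 / ((k : ℝ) + 1) ^ 2)) P :=
    AEMeasurable.tsum fun k => (hint k).aemeasurable.ennreal_ofReal
  filter_upwards [ae_lt_top' hmeas hfin] with ω hω
  have := ENNReal.summable_toReal hω.ne
  refine this.congr fun k => ?_
  rw [ENNReal.toReal_ofReal (by positivity)]

lemma ae_tendsto_average_norm_sq (hlaw : ∀ k, HasLaw (ζ k) stdComplexGaussian P)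
    (hindep : iIndepFun ζ P) :
    ∀ᵐ ω ∂P, Tendsto (fun N : ℕ => (∑ n ∈ Finset.range N, ‖ζ n ω‖ ^ 2) / N) atTop (𝓝 1) := by
  have hm : Measurable fun z : ℂ => ‖z‖ ^ 2 := by fun_prop
  have h := strong_law_ae_real (fun n ω => ‖ζ n ω‖ ^ 2) (integrable_norm_sq (hlaw 0))
    (fun i j hij => (hindep.indepFun hij).comp hm hm)
    (fun i => (IdentDistrib.mk (hlaw i).aemeasurable (hlaw 0).aemeasurable
      ((hlaw i).map_eq.trans (hlaw 0).map_eq.symm)).comp hm)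
  rwa [integral_norm_sq (hlaw 0)] at h

variable [IsProbabilityMeasure P]

lemma measure_le_re_sum_le (hlaw : ∀ k, HasLaw (ζ k) stdComplexGaussian P)
    (hindep : iIndepFun ζ P) {a : ℕ → ℂ} {K : ℕ} (ha : ∑ k ∈ Finset.range K, ‖a k‖ ^ 2 ≤ 1)
    {t : ℝ} (ht : 0 ≤ t) :
    P {ω | t ≤ (∑ k ∈ Finset.range K, ζ k ω * a k).re} ≤ ENNReal.ofReal (Real.exp (-t ^ 2 / 2)) := by
  have hind : iIndepFun (fun k ω => (ζ k ω * a k).re) P :=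
    hindep.comp (fun k z => (z * a k).re) fun k =>
      Complex.measurable_re.comp (measurable_id.mul_const _)
  have h := HasSubgaussianMGF.sum_of_iIndepFun hind (s := Finset.range K)
    fun k _ => hasSubgaussianMGF_re_mul (hlaw k) (a k)
  have hc : ∑ k ∈ Finset.range K, ‖a k‖₊ ^ 2 ≤ 1 := by
    rw [← NNReal.coe_le_coe]
    push_cast
    exact ha
  have h1 := (hasSubgaussianMGF_mono h hc).measure_ge_le ht
  simp only [NNReal.coe_one, mul_one] at h1
  simp only [Complex.re_sum]
  rw [← ENNReal.ofReal_toReal (measure_ne_top P _)]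
  exact ENNReal.ofReal_le_ofReal h1

/-- Gaussian tail bound for one direction of a random series with square-summable coefficients. -/
lemma measure_lt_re_le (hlaw : ∀ k, HasLaw (ζ k) stdComplexGaussian P)
    (hindep : iIndepFun ζ P) {a : ℕ → ℂ} (ha : ∀ K, ∑ k ∈ Finset.range K, ‖a k‖ ^ 2 ≤ 1)
    {Y : Ω → ℂ} (hY : ∀ᵐ ω ∂P, HasSum (fun k => ζ k ω * a k) (Y ω)) {t : ℝ} (ht : 0 ≤ t) :
    P {ω | t < (Y ω).re} ≤ ENNReal.ofReal (Real.exp (-t ^ 2 / 2)) := by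
  set s : ℕ → Set Ω := fun K => {ω | t ≤ (∑ k ∈ Finset.range K, ζ k ω * a k).re} with hs
  -- A strict inequality in the limit holds for all late partial sums. The tail intersections
  -- increase, so continuity of measure preserves the uniform bound.
  have hsub : {ω | t < (Y ω).re} ≤ᵐ[P] ⋃ K, ⋂ j ≥ K, s j := by
    filter_upwards [hY] with ω hω hlt
    have h1 : Tendsto (fun K => (∑ k ∈ Finset.range K, ζ k ω * a k).re) atTop (𝓝 (Y ω).re) :=
      (Complex.continuous_re.tendsto _).comp hω.tendsto_sum_nat
    obtain ⟨K, hK⟩ := eventually_atTop.1 (h1.eventually_const_lt hlt)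
    refine Set.mem_iUnion.2 ⟨K, Set.mem_iInter₂.2 fun j hj => ?_⟩
    exact (hK j hj).le
  have hmono : Monotone fun K => ⋂ j ≥ K, s j := fun K L hKL =>
    Set.biInter_subset_biInter_left fun j hj => le_trans hKL hj
  refine (measure_mono_ae hsub).trans ?_
  rw [hmono.measure_iUnion]
  refine iSup_le fun K => ?_
  exact (measure_mono (Set.biInter_subset_of_mem (le_refl K))).trans
    (measure_le_re_sum_le hlaw hindep (ha K) ht)

/-- If `‖Y‖² > 2t²` then the real or imaginary part exceeds `t` in absolute value. Each of the four
directions `±1, ±i` is absorbed into the coefficients, whose norms are unchanged. -/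
lemma measure_lt_norm_sq_le (hlaw : ∀ k, HasLaw (ζ k) stdComplexGaussian P)
    (hindep : iIndepFun ζ P) {a : ℕ → ℂ} (ha : ∀ K, ∑ k ∈ Finset.range K, ‖a k‖ ^ 2 ≤ 1)
    {Y : Ω → ℂ} (hY : ∀ᵐ ω ∂P, HasSum (fun k => ζ k ω * a k) (Y ω)) {t : ℝ} (ht : 0 ≤ t) :
    P {ω | 2 * t ^ 2 < ‖Y ω‖ ^ 2} ≤ 4 * ENNReal.ofReal (Real.exp (-t ^ 2 / 2)) := by
  have key : ∀ u : ℂ, ‖u‖ = 1 →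
      P {ω | t < (Y ω * u).re} ≤ ENNReal.ofReal (Real.exp (-t ^ 2 / 2)) := by
    intro u hu
    refine measure_lt_re_le hlaw hindep (a := fun k => a k * u) (fun K => ?_) ?_ ht
    · simpa [hu] using ha K
    · filter_upwards [hY] with ω hω
      simpa only [mul_assoc] using hω.mul_right u
  have hsub : {ω | 2 * t ^ 2 < ‖Y ω‖ ^ 2} ⊆
      ({ω | t < (Y ω * 1).re} ∪ {ω | t < (Y ω * -1).re}) ∪
      ({ω | t < (Y ω * Complex.I).re} ∪ {ω | t < (Y ω * -Complex.I).re}) := by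
    intro ω hω
    by_contra hcon
    simp only [Set.mem_union, Set.mem_ofPred_eq, not_or, not_lt, Complex.mul_re, Complex.neg_re,
      Complex.neg_im, Complex.one_re, Complex.one_im, Complex.I_re, Complex.I_im] at hcon hω
    obtain ⟨⟨h1, h2⟩, h3, h4⟩ := hcon
    rw [← Complex.normSq_eq_norm_sq, Complex.normSq_apply] at hω
    nlinarith
  refine (measure_mono hsub).trans ((measure_union_le _ _).trans ?_)
  refine (add_le_add (measure_union_le _ _) (measure_union_le _ _)).trans ?_
  calc _ ≤ (ENNReal.ofReal (Real.exp (-t ^ 2 / 2)) + ENNReal.ofReal (Real.exp (-t ^ 2 / 2))) +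
        (ENNReal.ofReal (Real.exp (-t ^ 2 / 2)) + ENNReal.ofReal (Real.exp (-t ^ 2 / 2))) := by
        gcongr <;> apply key <;> simp
    _ = _ := by ring

/-- Almost surely the weighted level fields are eventually at most logarithmic on fine lattices. -/
lemma ae_eventually_grid_le (hlaw : ∀ k, HasLaw (ζ k) stdComplexGaussian P)
    (hindep : iIndepFun ζ P) (R : ℕ) :
    ∀ᵐ ω ∂P, ∀ᶠ n : ℕ in atTop, ∀ p ∈ gridIndex R ((n + 2) ^ 3),
      ‖weightedLevel (fun k => ζ k ω) n (gridPoint ((n + 2) ^ 3) p)‖ ^ 2 ≤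
        32 * Real.log (n + 2) := by
  set s : ℕ → Set Ω := fun n => ⋃ p ∈ gridIndex R ((n + 2) ^ 3), {ω | 32 * Real.log (n + 2) <
    ‖weightedLevel (fun k => ζ k ω) n (gridPoint ((n + 2) ^ 3) p)‖ ^ 2} with hs
  set C : ℝ := 4 * (2 * R + 1) ^ 2 with hC
  have hbound : ∀ n, P (s n) ≤ ENNReal.ofReal (C * (1 / ((n : ℝ) + 2) ^ 2)) := by
    intro n
    have hn : (0 : ℝ) < (n : ℝ) + 2 := by positivity
    have hl : 0 ≤ Real.log ((n : ℝ) + 2) :=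
      Real.log_nonneg (by linarith [(Nat.cast_nonneg n : (0 : ℝ) ≤ n)])
    -- The choice makes `2t² = 32 log(n+2)` and the tail `(n+2)^{-8}`; a union over `O((n+2)^6)`
    -- lattice points leaves the summable `(n+2)^{-2}`.
    set t : ℝ := Real.sqrt (16 * Real.log (n + 2)) with ht
    have ht2 : t ^ 2 = 16 * Real.log (n + 2) := Real.sq_sqrt (by positivity)
    have hexp : Real.exp (-t ^ 2 / 2) = 1 / ((n : ℝ) + 2) ^ 8 := by
      rw [ht2, show -(16 * Real.log ((n : ℝ) + 2)) / 2 = -((8 : ℕ) * Real.log (n + 2)) by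
        push_cast; ring, Real.exp_neg, Real.exp_nat_mul, Real.exp_log hn, one_div]
    have hpt : ∀ p ∈ gridIndex R ((n + 2) ^ 3), P {ω | 32 * Real.log (n + 2) <
        ‖weightedLevel (fun k => ζ k ω) n (gridPoint ((n + 2) ^ 3) p)‖ ^ 2} ≤
        ENNReal.ofReal (4 * (1 / ((n : ℝ) + 2) ^ 8)) := by
      intro p _
      have h := measure_lt_norm_sq_le hlaw hindep
        (fun K => sum_norm_displacement_sq_le_one n K (gridPoint ((n + 2) ^ 3) p))
        (Y := fun ω => weightedLevel (fun k => ζ k ω) n (gridPoint ((n + 2) ^ 3) p))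
        (by filter_upwards [ae_admissibleCoeff hlaw] with ω hω using hω.hasSum_weightedLevel n _)
        (t := t) (Real.sqrt_nonneg _)
      rw [hexp, ht2, ← mul_assoc, show (2 : ℝ) * 16 = 32 by norm_num] at h
      rw [ENNReal.ofReal_mul (by norm_num), ENNReal.ofReal_ofNat]
      exact h
    refine (measure_biUnion_finset_le _ _).trans ((Finset.sum_le_card_nsmul _ _ _ hpt).trans ?_)
    rw [card_gridIndex, ← ENNReal.ofReal_nsmul]
    refine ENNReal.ofReal_le_ofReal ?_
    rw [nsmul_eq_mul]
    push_cast
    have h1 : 2 * ((R : ℝ) * ((n : ℝ) + 2) ^ 3) + 1 ≤ (2 * R + 1) * ((n : ℝ) + 2) ^ 3 := by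
      have : (1 : ℝ) ≤ ((n : ℝ) + 2) ^ 3 :=
        one_le_pow₀ (by linarith [(Nat.cast_nonneg n : (0 : ℝ) ≤ n)])
      nlinarith
    calc _ ≤ ((2 * R + 1) * ((n : ℝ) + 2) ^ 3) ^ 2 * (4 * (1 / ((n : ℝ) + 2) ^ 8)) := by
          gcongr
      _ = _ := by rw [hC]; field_simp
  have hsum : Summable fun n : ℕ => C * (1 / ((n : ℝ) + 2) ^ 2) := by
    have := (summable_nat_add_iff 2).2 (Real.summable_one_div_nat_pow.2 (one_lt_two))
    refine Summable.mul_left _ ?_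
    simpa using this
  have hfin : ∑' n, P (s n) ≠ ∞ :=
    ne_top_of_le_ne_top hsum.tsum_ofReal_ne_top (ENNReal.tsum_le_tsum hbound)
  filter_upwards [ae_eventually_notMem hfin] with ω hω
  filter_upwards [hω] with n hn p hp
  by_contra hcon
  exact hn (Set.mem_biUnion hp (not_le.1 hcon))

end IID

end LandauLevels

end

theorem theorem5p2 {Ω : Type*} [MeasurableSpace Ω] (P : Measure Ω) [IsProbabilityMeasure P]
    (ζ : ℕ → Ω → ℂ) (hlaw : ∀ k, HasLaw (ζ k) LandauLevels.stdComplexGaussian P)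
    (hindep : iIndepFun ζ P) :
    (∀ᵐ ω ∂P, ∀ z : ℂ, Summable (LandauLevels.gefTerm (fun k => ζ k ω) z)) ∧
    ∀ K : Set ℂ, IsCompact K → ∀ α : ℝ, 0 < α → α < 1 →
      ∀ᵐ ω ∂P, LandauLevels.TendstoHolder α K
        (fun N => LandauLevels.averagedField (fun k => ζ k ω) N) (fun _ => 1) := by
  refine ⟨?_, fun K hK α _ hα => ?_⟩
  · filter_upwards [LandauLevels.ae_admissibleCoeff hlaw] with ω hω z using hω.summable_gefTerm z
  · obtain ⟨r, hr⟩ := hK.isBounded.subset_closedBall 0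
    obtain ⟨R, hR⟩ := exists_nat_ge r
    filter_upwards [LandauLevels.ae_admissibleCoeff hlaw,
      LandauLevels.ae_tendsto_average_norm_sq hlaw hindep,
      LandauLevels.ae_eventually_grid_le hlaw hindep R] with ω h1 h2 h3
    exact h1.tendstoHolder R hα (hr.trans (Metric.closedBall_subset_closedBall hR)) h3 h2
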